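/- **Definitions.** Let $\Sigma$ be a finite alphabet consisting of free generators and their inverses for a finitely generated free group $F$; $|w|$ is the length of a word $w\in\Sigma^*$, $w^{-1}$ its formal inverse and $v^r$ the word $v$ written backwards. A *rational transduction* over $\Sigma$ is a relation $\rho\subset\Sigma^*\times\Sigma^*$ consisting of the labels of all successful paths of a finite automaton with edge labels in $(\Sigma\cup\{\varepsilon\})\times(\Sigma\cup\{\varepsilon\})$; it is *synchronized* if for some constant $k$, $\bigl||u|-|v|\bigr|\le k$ for all $(u,v)\in\rho$. A language $L\subset\Sigma^*$ is *linear* if $L=\{uv^r\mid (u,v)\in\rho\}$ for some rational transduction $\rho$. A language $L$ of nonempty freely reduced words is a *language of generators* of a subgroup $N\le F$ if its image in $F$ generates $N$. It *has significant letters* if every $w\in L$ can be written $w=uav^{-1}$ with $a\in\Sigma$ (the significant letter of $w$) so that for all $w_1,w_2\in L$ and all $\epsilon_1,\epsilon_2=\pm1$, free reduction of $w_1^{\epsilon_1}w_2^{\epsilon_2}=(u_1a_1v_1^{-1})^{\epsilon_1}(u_2a_2v_2^{-1})^{\epsilon_2}$ does not affect $a_1$ or $a_2$ unless the product reduces to $\varepsilon$.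 The distance of the $i$-th letter of a word of length $n$ from the center of the word is $|i-(n+1)/2|$. The significant letters are *$k$-central* if each is within distance $k$ of the center of its word; they are *$o$-central* if $L$ is finite or the distance of the significant letter from the center is $o$ of the length of the word. A *synchronous automatic structure* on a group $G$ consists of a finite alphabet $A$ with a map to $G$, and a regular language $C\subset A^*$ mapping onto $G$ such that for every $x\in A\cup\{\varepsilon\}$ the set of pairs $(u,v)$ with $u,v\in C$ and $ux=v$ in $G$ is accepted, after padding the shorter word at its end, by a finite automaton reading both words synchronously. It is *prefix-closed* if every prefix of a word of $C$ is in $C$, and has *uniqueness* if $C$ maps injectively to $G$. **Theorem.** For a group $G$ the following are equivalent. 0. $G$ has a prefix-closed synchronous automatic structure with uniqueness. 1. $G$ is isomorphic to a quotient $F/N$ of a finitely generated free group $F$ by a normal subgroup $N$ admitting a linear language $L$ of freely reduced generators with significant letters which, for some constant $k$, are $k$-central. 2. $G$ is isomorphic to a quotient $F/N$ of a finitely generated free group $F$ by a normal subgroup $N$ admitting a linear language $L$ of freely reduced generators with significant letters which are $o$-central. Moreover, for $F$, $N$, $L$ and significant letters as in (2), every rational transduction $\tau$ with $L=\{uv^{-1}\mid(u,v)\in\tau\}$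 is synchronized, and there is a constant $k$ such that for every $w=uav^{-1}\in L$ with significant letter $a$ the words $u$ and $v$ are synchronous $k$-fellow travelers in $F/N$: for every $t\ge 0$ the prefixes of length $t$ of $u$ and $v$ (a shorter word standing for itself) represent elements of $F/N$ at distance at most $k$ in the word metric of $\Sigma$. -/

import Mathlib

namespace AutGroup

/-! ### Automatic structures -/

/-- The element of `G` represented by a word over an alphabet `A` of generators `p : A → G`. -/
def eval {A G : Type*} [Group G] (p : A → G) (w : List A) : G := (w.map p).prod

/-- The padded word over `(A ∪ {$}) × (A ∪ {$})` of a pair of words; `none` is the padding symbol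
`$`, which is appended to the shorter word. -/
def pad {A : Type*} (u v : List A) : List (Option A × Option A) := List.zipWithAll Prod.mk u v

/-- The language `C` over the alphabet `A` of generators `p : A → G` is the set of accepted words
of a synchronous automatic structure on `G`: it is regular, it maps onto `G`, and for each
`x ∈ A ∪ {ε}` the padded pairs `(u, v)` with `u, v ∈ C` and `u x = v` in `G` are accepted by a finite
automaton. -/
structure IsSynchronousAutomatic {A G : Type*} [Group G] (p : A → G) (C : Language A) : Prop where
  regular : C.IsRegular
  surjective : ∀ g : G, ∃ w ∈ C, eval p w = g
  multiplier : ∀ x : Option A, Language.IsRegular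
    ({z | ∃ u ∈ C, ∃ v ∈ C, eval p (u ++ x.toList) = eval p v ∧ z = pad u v} :
      Language (Option A × Option A))

/-- Every prefix of a word of `C` is in `C`. -/
def PrefixClosed {A : Type*} (C : Language A) : Prop := ∀ u w : List A, u <+: w → w ∈ C → u ∈ C

/-- Each element of `G` is represented by at most one word of `C`. -/
def Uniqueness {A G : Type*} [Group G] (p : A → G) (C : Language A) : Prop :=
  ∀ u ∈ C, ∀ v ∈ C, eval p u = eval p v → u = v

/-- `G` has a prefix-closed synchronous automatic structure with uniqueness. -/
def HasPrefixClosedSynchronousStructure (G : Type*) [Group G] : Prop :=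
  ∃ (A : Type) (_ : Finite A) (p : A → G) (C : Language A),
    IsSynchronousAutomatic p C ∧ PrefixClosed C ∧ Uniqueness p C

/-! ### Rational transductions and linear languages -/

/-- An automaton over `A × A` with vertex set `V`: edges are labelled by pairs from
`(A ∪ {ε}) × (A ∪ {ε})`, where `none` stands for `ε`. -/
structure Transducer (A V : Type*) where
  edge : V → Option A × Option A → V → Prop
  initial : V
  terminal : Set V

/-- `T.Path p q u v`: there is a path from `p` to `q` whose label is `(u, v)`. -/
inductive Transducer.Path {A V : Type*} (T : Transducer A V) : V → V → List A → List A → Prop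
  | nil (p : V) : T.Path p p [] []
  | cons (p q r : V) (a b : Option A) (u v : List A) :
      T.edge p (a, b) q → T.Path q r u v → T.Path p r (a.toList ++ u) (b.toList ++ v)

/-- The binary relation on words given by the labels of successful paths. -/
def Transducer.accepts {A V : Type*} (T : Transducer A V) : Set (List A × List A) :=
  {x | ∃ q ∈ T.terminal, T.Path T.initial q x.1 x.2}

/-- Rational transductions: relations accepted by an automaton with finitely many vertices. -/
def IsRationalTransduction {A : Type*} (ρ : Set (List A × List A)) : Prop :=
  ∃ (V : Type) (_ : Finite V) (T : Transducer A V), T.accepts = ρ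

/-- The lengths of the two words of any pair in `ρ` differ by at most a constant. -/
def IsSynchronized {A : Type*} (ρ : Set (List A × List A)) : Prop :=
  ∃ k : ℕ, ∀ x ∈ ρ, x.1.length ≤ x.2.length + k ∧ x.2.length ≤ x.1.length + k

/-- Linear languages: languages `{u vʳ | (u, v) ∈ ρ}` with `ρ` a rational transduction. -/
def IsLinear {A : Type*} (L : Language A) : Prop :=
  ∃ ρ : Set (List A × List A), IsRationalTransduction ρ ∧
    ∀ w : List A, w ∈ L ↔ ∃ x ∈ ρ, w = x.1 ++ x.2.reverse

/-! ### Significant letters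

The alphabet of free generators and their inverses of `FreeGroup α` is `α × Bool`, with `(a, true)`
standing for `a` and `(a, false)` for `a⁻¹`. The formal inverse of a word is `FreeGroup.invRev`. -/

/-- A word with a distinguished letter. -/
structure MarkedWord (α : Type*) where
  pre : List (α × Bool)
  letter : α × Bool
  suf : List (α × Bool)

namespace MarkedWord

variable {α : Type*}

/-- The underlying word. -/
def word (m : MarkedWord α) : List (α × Bool) := m.pre ++ m.letter :: m.suf

/-- The formal inverse, with the inverse of the distinguished letter distinguished. -/
def inv (m : MarkedWord α) : MarkedWord α :=
  ⟨FreeGroup.invRev m.suf, (m.letter.1, !m.letter.2), FreeGroup.invRev m.pre⟩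

/-- `m.signed true = m` and `m.signed false = m⁻¹`. -/
def signed (m : MarkedWord α) (ε : Bool) : MarkedWord α := if ε then m else m.inv

/-- Free reduction of the product of `m₁` and `m₂` affects neither distinguished letter: the
product is brought to freely reduced form by cancellations strictly between these two letters. -/
def Unaffected (m₁ m₂ : MarkedWord α) : Prop :=
  ∃ z : List (α × Bool), FreeGroup.Red (m₁.suf ++ m₂.pre) z ∧
    FreeGroup.IsReduced (m₁.pre ++ m₁.letter :: (z ++ m₂.letter :: m₂.suf))

/-- The distance `|i - (n + 1) / 2|` from the distinguished letter, the `i`-th of the word (counting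
from `1`), to the center of the word, whose length is `n`. -/
noncomputable def distCenter (m : MarkedWord α) : ℝ :=
  |((m.pre.length + 1 : ℕ) : ℝ) - ((m.word.length : ℝ) + 1) / 2|

end MarkedWord

/-- `L` consists of nonempty freely reduced words, and the letters distinguished by `d` are
significant letters for `L`. -/
structure IsSignificant {α : Type*} (L : Language (α × Bool))
    (d : List (α × Bool) → MarkedWord α) : Prop where
  ne_nil : ∀ w ∈ L, w ≠ []
  reduced : ∀ w ∈ L, FreeGroup.IsReduced w
  word_eq : ∀ w ∈ L, (d w).word = w
  significant : ∀ w₁ ∈ L, ∀ w₂ ∈ L, ∀ ε₁ ε₂ : Bool,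
    ¬ FreeGroup.Red (((d w₁).signed ε₁).word ++ ((d w₂).signed ε₂).word) [] →
      ((d w₁).signed ε₁).Unaffected ((d w₂).signed ε₂)

/-- For some constant `k` each distinguished letter is `k`-central. -/
def IsKCentral {α : Type*} (L : Language (α × Bool))
    (d : List (α × Bool) → MarkedWord α) : Prop :=
  ∃ k : ℝ, ∀ w ∈ L, (d w).distCenter ≤ k

/-- The distinguished letters are `o`-central: `L` is finite, or the distance to the center is
`o` of the length of the word. -/
def IsOCentral {α : Type*} (L : Language (α × Bool))
    (d : List (α × Bool) → MarkedWord α) : Prop :=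
  {w | w ∈ L}.Finite ∨
    ∀ c : ℝ, 0 < c → ∃ n : ℕ, ∀ w ∈ L, n ≤ w.length → (d w).distCenter ≤ c * (w.length : ℝ)

/-- `L` is a language of generators for the subgroup `N` of the free group. -/
def Generates {α : Type*} (L : Language (α × Bool)) (N : Subgroup (FreeGroup α)) : Prop :=
  Subgroup.closure {g | ∃ w ∈ L, FreeGroup.mk w = g} = N

/-- `u` and `v` are synchronous `k`-fellow travelers in the Cayley diagram of `FreeGroup α ⧸ N`: for
each `t` the vertices reached after `t` letters are at most `k` apart in the word metric. -/
def SyncFellowTravel {α : Type*} (N : Subgroup (FreeGroup α)) (k : ℕ)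
    (u v : List (α × Bool)) : Prop :=
  ∀ t : ℕ, ∃ x : List (α × Bool), x.length ≤ k ∧
    (QuotientGroup.mk (FreeGroup.mk (u.take t ++ x)) : FreeGroup α ⧸ N) =
      QuotientGroup.mk (FreeGroup.mk (v.take t))

end AutGroup

namespace AutGroup

open FreeGroup

/-! ### Reduced words and cancellation in free groups -/

section Words

variable {α : Type*}

/-! Significant letters are Nielsen's condition, and the theorem is the correspondence between
Nielsen generators and Schreier transversals, carried out with finite automata.

Given an automatic structure, the prefix-closed set C of unique representatives is a Schreier
transversal of the kernel of the map from the free group on its alphabet. The kernel is generated by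
the words u a v⁻¹ with u, v ∈ C, where u a = v in the group but not as words
(`generates_schreierLanguage`). Prefix closure and uniqueness protect the letter a
(`SignedTriple.unaffected`). The multiplier automata become a transducer
(`isLinear_schreierLanguage`). For fixed a the words u and v determine each other, so pumping in the
padding bounds the difference of their lengths, and a is k-central.

Conversely, a word of L is determined by its beginning up to and including its significant letter
(`IsSignificant.eq_of_prefix`). This has two kinds of consequences.

Algebraically, the prefixes of the parts of generators and their inverses in front of the
significant letters form a tree. If N is nontrivial, it contains each coset exactly once
(`IsMarking.markTree_injective`, `IsMarking.markTree_surjective`), and the remaining edges of the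
coset graph come from generators (`IsMarking.markTree_edge`).

For automata, a loop with labels of different lengths could be pumped until the significant letter
lies in a part which further pumping does not change, so all loops are balanced (`loop_length_eq`).
Paths can be completed by bounded ones; a bounded completion just behind the significant letter must
give back the same word, so o-central letters are within bounded distance of the center
(`exists_length_le_pre_suf`). Bounded completions also give fellow traveling
(`exists_syncFellowTravel`).

The tree is not evidently regular, as no automaton is given which sees the significant letters. It
is replaced by a regular, prefix-closed and coarsely dense part, consisting of first labels which
stop well before the center (`initialLanguage_subset`, `exists_mem_initialLanguage`). The missing
elements are reached by a single extra letter at the end (`extension`). -/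

theorem isReduced_append_iff {A B : List (α × Bool)} :
    IsReduced (A ++ B) ↔ IsReduced A ∧ IsReduced B ∧
      ∀ a ∈ A.getLast?, ∀ b ∈ B.head?, a.1 = b.1 → a.2 = b.2 := List.isChain_append

theorem isReduced_invRev {A : List (α × Bool)} (h : IsReduced A) : IsReduced (invRev A) := by
  classical
  rw [isReduced_iff_reduce_eq, reduce_invRev, h.reduce_eq]

theorem isReduced_left {A B : List (α × Bool)} (h : IsReduced (A ++ B)) : IsReduced A :=
  (isReduced_append_iff.1 h).1

theorem isReduced_right {A B : List (α × Bool)} (h : IsReduced (A ++ B)) : IsReduced B :=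
  (isReduced_append_iff.1 h).2.1

theorem isReduced_of_prefix {A B : List (α × Bool)} (h : IsReduced B) (hA : A <+: B) :
    IsReduced A := h.infix hA.isInfix

theorem eq_of_mk_eq {A B : List (α × Bool)} (hA : IsReduced A) (hB : IsReduced B)
    (h : mk A = mk B) : A = B := by
  classical
  rw [← hA.reduce_eq, ← hB.reduce_eq, reduce.sound h]

theorem mk_invRev_mul (A : List (α × Bool)) : mk (invRev A) * mk A = 1 := by
  rw [← inv_mk, inv_mul_cancel]

theorem invRev_singleton (a : α × Bool) : invRev [a] = [(a.1, !a.2)] := rfl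

theorem invRev_cons' (a : α × Bool) (L : List (α × Bool)) :
    invRev (a :: L) = invRev L ++ [(a.1, !a.2)] := by
  rw [invRev_cons, invRev_singleton]

theorem invRev_concat (a : α × Bool) (L : List (α × Bool)) :
    invRev (L ++ [a]) = (a.1, !a.2) :: invRev L := by
  rw [invRev_append, invRev_singleton]; rfl

theorem flip_flip (a : α × Bool) : ((a.1, !a.2).1, !(a.1, !a.2).2) = a := by simp

theorem eq_flip_iff {a b : α × Bool} : b = (a.1, !a.2) ↔ ¬ (a.1 = b.1 → a.2 = b.2) := by
  obtain ⟨x, i⟩ := a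
  obtain ⟨y, j⟩ := b
  cases i <;> cases j <;> simp [eq_comm]

/-- In the product of two reduced words a maximal common part is cancelled. -/
theorem exists_cancel {A B : List (α × Bool)} (hA : IsReduced A) (hB : IsReduced B) :
    ∃ A' c B', A = A' ++ c ∧ B = invRev c ++ B' ∧ IsReduced (A' ++ B') := by
  induction A using List.reverseRecOn generalizing B with
  | nil => exact ⟨[], [], B, by simp, by simp, by simpa⟩
  | append_singleton A a ih =>
    cases B with
    | nil => exact ⟨A ++ [a], [], [], by simp, by simp, by simpa⟩
    | cons b B =>
      by_cases hab : a.1 = b.1 → a.2 = b.2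
      · refine ⟨A ++ [a], [], b :: B, by simp, by simp, ?_⟩
        rw [isReduced_append_iff]
        refine ⟨hA, hB, ?_⟩
        simpa using hab
      · obtain ⟨A', c, B', h1, h2, h3⟩ := ih (isReduced_left hA)
          (isReduced_right (A := [b]) hB)
        refine ⟨A', c ++ [a], B', by simp [h1], ?_, h3⟩
        rw [invRev_concat, eq_flip_iff.2 hab, h2]; rfl

theorem mk_append_cancel (A c B : List (α × Bool)) :
    mk ((A ++ c) ++ (invRev c ++ B)) = mk (A ++ B) := by
  rw [← mul_mk, ← mul_mk, ← mul_mk, ← mul_mk, ← inv_mk]; group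

/-- Free groups have no elements of order 2. -/
theorem ne_invRev {A : List (α × Bool)} (hA : IsReduced A) (hne : A ≠ []) : A ≠ invRev A := by
  classical
  intro h
  have h1 : mk A ^ 2 = 1 := by
    rw [pow_two]; nth_rewrite 1 [h]; exact mk_invRev_mul A
  have h2 : mk A = 1 := by
    by_contra h3
    exact h3 ((pow_eq_one_iff_left two_ne_zero).1 h1)
  exact hne (eq_of_mk_eq hA IsReduced.nil h2)

theorem isCyclicallyReduced_of_append_self {A : List (α × Bool)} (h : IsReduced (A ++ A)) :
    IsCyclicallyReduced A :=
  ⟨isReduced_left h, (isReduced_append_iff.1 h).2.2⟩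

theorem isReduced_append_self {A : List (α × Bool)} (h : IsCyclicallyReduced A) :
    IsReduced (A ++ A) := isReduced_append_iff.2 ⟨h.1, h.1, h.2⟩

/-- Every reduced word is a prefix of a reduced word representing an element of a given nontrivial
normal subgroup. -/
theorem exists_prefix_mem_normal {N : Subgroup (FreeGroup α)} [hN : N.Normal] (hne : N ≠ ⊥)
    {g : List (α × Bool)} (hg : IsReduced g) : ∃ R, IsReduced (g ++ R) ∧ mk (g ++ R) ∈ N := by
  classical
  obtain ⟨n, hn, hn1⟩ : ∃ n : FreeGroup α, n ∈ N ∧ n ≠ 1 := by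
    obtain ⟨n, h⟩ := Subgroup.ne_bot_iff_exists_ne_one.1 hne
    exact ⟨n, n.2, fun h' => h (Subtype.ext h')⟩
  -- By normality n may be replaced by its cyclic reduction, whose powers involve no cancellation.
  obtain ⟨c, hc, hcN, hc0⟩ : ∃ c, IsReduced (c ++ c) ∧ mk c ∈ N ∧ c ≠ [] := by
    have hconj := reduceCyclically.conj_conjugator_reduceCyclically n.toWord
    have hmk : mk (reduceCyclically n.toWord) =
        (mk (reduceCyclically.conjugator n.toWord))⁻¹ * n *
          (mk (reduceCyclically.conjugator n.toWord)) := by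
      nth_rewrite 3 [← mk_toWord (x := n)]
      nth_rewrite 3 [← hconj]
      rw [← mul_mk, ← mul_mk, ← inv_mk]; group
    refine ⟨reduceCyclically n.toWord, isReduced_append_self
      (reduceCyclically.isCyclicallyReduced isReduced_toWord), ?_, ?_⟩
    · rw [hmk]
      simpa using hN.conj_mem n hn (mk (reduceCyclically.conjugator n.toWord))⁻¹
    · intro h0
      rw [h0] at hmk
      apply hn1
      have : (1 : FreeGroup α) = _ := hmk
      rw [eq_comm, mul_assoc, inv_mul_eq_one] at this
      simpa using this
  -- If g cancelled against both c and c⁻¹, its last letter would be the inverse of the first letter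
  -- of c and also the last letter of c, so that c c would not be reduced.
  obtain ⟨d, hd, hdN, hd0, hgd⟩ : ∃ d, IsReduced (d ++ d) ∧ mk d ∈ N ∧ d ≠ [] ∧
      IsReduced (g ++ d) := by
    by_cases h : IsReduced (g ++ c)
    · exact ⟨c, hc, hcN, hc0, h⟩
    · have hci : IsReduced (invRev c ++ invRev c) := by
        rw [← invRev_append]; exact isReduced_invRev hc
      refine ⟨invRev c, hci, by rw [← inv_mk]; exact N.inv_mem hcN, ?_, ?_⟩
      · intro h0; apply hc0; simpa using congrArg List.length h0
      · rw [isReduced_append_iff] at h ⊢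
        refine ⟨hg, isReduced_left hci, fun a ha b hb => ?_⟩
        obtain ⟨c', l, rfl⟩ : ∃ c' l, c = c' ++ [l] := by
          rcases List.eq_nil_or_concat c with h | h
          · exact absurd h hc0
          · simpa using h
        rw [invRev_concat] at hb
        simp only [List.head?_cons, Option.mem_some_iff] at hb
        subst hb
        by_contra hcon
        apply h
        refine ⟨hg, isReduced_left hc, fun a' ha' b' hb' => ?_⟩
        have h1 := (isReduced_append_iff.1 hc).2.2 l (by simp) b' hb'
        have haa : a = a' := by
          rw [Option.mem_def] at ha ha'; rw [ha] at ha'; simpa using ha'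
        rw [← haa]
        obtain ⟨x, i⟩ := a
        obtain ⟨y, j⟩ := l
        obtain ⟨z, k⟩ := b'
        cases i <;> cases j <;> cases k <;> simp_all
  have hB := IsReduced.append_flatten_replicate_append (L₁ := g) (L₃ := [])
    (isCyclicallyReduced_of_append_self hd) (by simpa using hgd) (Nat.succ_ne_zero g.length)
  set B := (List.replicate (g.length + 1) d).flatten with hBdef
  have hBlen : g.length ≤ B.length := by
    have : 0 < d.length := List.length_pos_iff.2 hd0
    simp only [hBdef, List.length_flatten, List.map_replicate, List.sum_replicate, smul_eq_mul]
    nlinarith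
  have hBN : mk B ∈ N := by
    rw [hBdef, ← pow_mk]; exact N.pow_mem hdN _
  rw [List.append_nil] at hB
  -- In the product of g B and g⁻¹ at most |g| ≤ |B| letters of g B cancel, so the prefix g survives
  -- in the conjugate of B.
  obtain ⟨A', e, B', h1, h2, h3⟩ := exists_cancel hB (isReduced_invRev hg)
  have hle : g.length ≤ A'.length := by
    have e1 := congrArg List.length h1
    have e2 := congrArg List.length h2
    simp only [List.length_append, invRev_length] at e1 e2
    omega
  obtain ⟨R, rfl⟩ : g <+: A' :=
    List.prefix_of_prefix_length_le (List.prefix_append g B) ⟨e, h1.symm⟩ hle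
  refine ⟨R ++ B', by simpa using h3, ?_⟩
  have : mk (g ++ (R ++ B')) = mk g * mk B * (mk g)⁻¹ := by
    rw [← List.append_assoc, ← mk_append_cancel _ e, ← h1, ← h2, inv_mk, mul_mk, mul_mk]
  rw [this]
  exact hN.conj_mem _ hBN _

end Words

end AutGroup

namespace AutGroup

open FreeGroup

/-! ### From significant letters to a tree of coset representatives -/

section Marks

variable {α : Type*}

namespace MarkedWord

theorem word_inv (m : MarkedWord α) : m.inv.word = invRev m.word := by
  simp [word, inv, invRev_append, invRev_cons']

theorem inv_inv (m : MarkedWord α) : m.inv.inv = m := by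
  simp [inv]

theorem prefix_word (m : MarkedWord α) : m.pre ++ [m.letter] <+: m.word :=
  ⟨m.suf, by simp [word]⟩

theorem length_word (m : MarkedWord α) : m.word.length = m.pre.length + 1 + m.suf.length := by
  simp [word]; omega

theorem length_inv_pre (m : MarkedWord α) : m.inv.pre.length = m.suf.length := by
  simp [inv]

theorem word_ne_nil (m : MarkedWord α) : m.word ≠ [] := by simp [word]

/-- If the product of `m₁⁻¹` and `m₂` does not affect the distinguished letters, then `m₂` does not
begin like `m₁` up to and including the distinguished letter of `m₁`. -/
theorem Unaffected.not_prefix {m₁ m₂ : MarkedWord α} (h : m₁.inv.Unaffected m₂)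
    (h₁ : IsReduced m₁.word) (h₂ : IsReduced m₂.word) :
    ¬ m₁.pre ++ [m₁.letter] <+: m₂.word := by
  rintro ⟨t, ht⟩
  obtain ⟨z, hz, hred⟩ := h
  have hzr : IsReduced z := hred.infix
    ⟨m₁.inv.pre ++ [m₁.inv.letter], m₂.letter :: m₂.suf, by simp⟩
  have hmk : FreeGroup.mk z = (FreeGroup.mk m₁.pre)⁻¹ * FreeGroup.mk m₂.pre := by
    rw [inv_mk, mul_mk]; exact (Red.exact.2 ⟨z, hz, .refl⟩).symm
  have hp₁ : IsReduced m₁.pre := isReduced_left h₁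
  have hp₂ : IsReduced m₂.pre := isReduced_left h₂
  have key : ∀ (a : α × Bool) (A B : List (α × Bool)),
      ¬ IsReduced (A ++ ((a.1, !a.2) :: a :: B)) := by
    intro a A B hr
    have := isReduced_right hr
    simp at this
  simp only [word, List.append_assoc, List.singleton_append] at ht
  -- The word z is the reduced form of the inverse of `m₁.pre` times `m₂.pre`, flanked by the
  -- inverse of `m₁.letter` and by `m₂.letter`. Whichever front part is longer, a letter meets its
  -- inverse at an end of z, or the two flanking letters meet.
  rcases List.append_eq_append_iff.1 ht with ⟨s, h1, h2⟩ | ⟨s, h1, h2⟩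
  · cases s with
    | nil =>
      simp only [List.append_nil] at h1
      simp only [List.nil_append, List.cons.injEq] at h2
      have : z = [] := by
        apply eq_of_mk_eq hzr IsReduced.nil
        rw [hmk, h1, inv_mul_cancel]; rfl
      subst this
      rw [← h2.1] at hred
      exact key _ _ _ hred
    | cons b s =>
      simp only [List.cons_append, List.cons.injEq] at h2
      have : z = b :: s := by
        apply eq_of_mk_eq hzr (isReduced_right (h1 ▸ hp₂))
        rw [hmk, h1, ← mul_mk, inv_mul_cancel_left]
      subst this
      rw [← h2.1] at hred
      exact key _ _ _ hred
  · cases s with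
    | nil =>
      simp only [List.append_nil] at h1
      simp only [List.nil_append, List.cons.injEq] at h2
      have : z = [] := by
        apply eq_of_mk_eq hzr IsReduced.nil
        rw [hmk, h1, inv_mul_cancel]; rfl
      subst this
      rw [h2.1] at hred
      exact key _ _ _ hred
    | cons b s =>
      simp only [List.cons_append, List.cons.injEq] at h2
      have : z = invRev (b :: s) := by
        apply eq_of_mk_eq hzr (isReduced_invRev (isReduced_right (h1 ▸ hp₁)))
        rw [hmk, h1, ← mul_mk, mul_inv_rev, inv_mul_cancel_right, inv_mk]
      subst this
      rw [h2.1, invRev_cons'] at hred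
      apply key b (m₁.inv.pre ++ m₁.inv.letter :: invRev s) m₂.suf
      simpa using hred

end MarkedWord

/-- A set of reduced marked words closed under inversion such that distinguished letters survive in
nontrivial products of two elements. -/
structure IsMarking (M : Set (MarkedWord α)) : Prop where
  reduced : ∀ m ∈ M, IsReduced m.word
  inv_mem : ∀ m ∈ M, m.inv ∈ M
  unaffected : ∀ m₁ ∈ M, ∀ m₂ ∈ M, m₂ ≠ m₁.inv → m₁.Unaffected m₂

/-- The words which are prefixes of the part of a marked word in front of its distinguished
letter. -/
def markTree (M : Set (MarkedWord α)) : Set (List (α × Bool)) := {t | ∃ m ∈ M, t <+: m.pre}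

/-- The subgroup generated by the underlying words of a set of marked words. -/
def markSubgroup (M : Set (MarkedWord α)) : Subgroup (FreeGroup α) :=
  Subgroup.closure {g | ∃ m ∈ M, FreeGroup.mk m.word = g}

theorem mk_word_mem {M : Set (MarkedWord α)} {m : MarkedWord α} (hm : m ∈ M) :
    FreeGroup.mk m.word ∈ markSubgroup M := Subgroup.subset_closure ⟨m, hm, rfl⟩

namespace IsMarking

variable {M : Set (MarkedWord α)} (hM : IsMarking M)
include hM

/-- Otherwise the product of m₁⁻¹ and m₂ would cancel the distinguished letter of m₁. -/
theorem eq_of_prefix {m₁ m₂ : MarkedWord α} (h₁ : m₁ ∈ M) (h₂ : m₂ ∈ M)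
    (h : m₁.pre ++ [m₁.letter] <+: m₂.word) : m₁ = m₂ := by
  by_contra hne
  refine (hM.unaffected m₁.inv (hM.inv_mem _ h₁) m₂ h₂ ?_).not_prefix (hM.reduced _ h₁)
    (hM.reduced _ h₂) h
  rw [MarkedWord.inv_inv]
  exact Ne.symm hne

/-- Neighbouring factors cancel only strictly between their distinguished letters, so the beginning
of the first factor and the end of the last one, including these letters, survive. -/
theorem exists_reduced_chain (m : MarkedWord α) (ms : List (MarkedWord α))
    (hm : ∀ x ∈ m :: ms, x ∈ M) (hc : (m :: ms).IsChain fun a b => b ≠ a.inv) :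
    ∃ R, FreeGroup.mk (((m :: ms).map MarkedWord.word).flatten) = FreeGroup.mk (m.pre ++ m.letter :: R) ∧
      IsReduced (m.pre ++ m.letter :: R) ∧
      ((ms = [] ∧ R = m.suf) ∨ ∃ m' ∈ M, ∃ R', R = R' ++ m'.letter :: m'.suf) := by
  induction ms generalizing m with
  | nil =>
    refine ⟨m.suf, by simp [MarkedWord.word], hM.reduced m (hm m (by simp)), Or.inl ⟨rfl, rfl⟩⟩
  | cons m₂ ms ih =>
    rw [List.isChain_cons_cons] at hc
    obtain ⟨R, h1, h2, h3⟩ := ih m₂ (fun x hx => hm x (List.mem_cons_of_mem _ hx)) hc.2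
    obtain ⟨z, hz, hr⟩ := hM.unaffected m (hm m (by simp)) m₂ (hm m₂ (by simp)) hc.1
    have hzmk : FreeGroup.mk (m.suf ++ m₂.pre) = FreeGroup.mk z := Red.exact.2 ⟨z, hz, .refl⟩
    refine ⟨z ++ m₂.letter :: R, ?_, ?_, Or.inr ?_⟩
    · have e1 : ((m :: m₂ :: ms).map MarkedWord.word).flatten =
          m.word ++ ((m₂ :: ms).map MarkedWord.word).flatten := by simp
      have e2 : m.pre ++ m.letter :: (z ++ m₂.letter :: R) =
          (m.pre ++ [m.letter]) ++ z ++ (m₂.letter :: R) := by simp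
      have e3 : m.word ++ (m₂.pre ++ m₂.letter :: R) =
          (m.pre ++ [m.letter]) ++ (m.suf ++ m₂.pre) ++ (m₂.letter :: R) := by
        simp [MarkedWord.word]
      rw [e1, ← mul_mk, h1, mul_mk, e3, e2, ← mul_mk, ← mul_mk, hzmk, mul_mk, mul_mk]
    · have e : m.pre ++ m.letter :: (z ++ m₂.letter :: R) =
          (m.pre ++ m.letter :: z) ++ [m₂.letter] ++ R := by simp
      rw [e]
      -- Two reduced words are glued along their common letter `m₂.letter`.
      refine IsReduced.append_overlap ?_ ?_ (by simp)
      · exact hr.infix ⟨[], m₂.suf, by simp⟩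
      · exact isReduced_right h2
    · rcases h3 with ⟨rfl, rfl⟩ | ⟨m', hm', R', rfl⟩
      · exact ⟨m₂, hm m₂ (by simp), z, rfl⟩
      · exact ⟨m', hm', z ++ m₂.letter :: R', by simp⟩

/-- Left multiplication by m lengthens a chain, unless the chain starts with m⁻¹; then it deletes
this factor. -/
theorem exists_chain {n : FreeGroup α} (hn : n ∈ markSubgroup M) :
    ∃ ms : List (MarkedWord α), (∀ x ∈ ms, x ∈ M) ∧ (ms.IsChain fun a b => b ≠ a.inv) ∧
      FreeGroup.mk ((ms.map MarkedWord.word).flatten) = n := by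
  have step : ∀ m ∈ M, ∀ n : FreeGroup α, (∃ ms : List (MarkedWord α), (∀ x ∈ ms, x ∈ M) ∧
      (ms.IsChain fun a b => b ≠ a.inv) ∧ FreeGroup.mk ((ms.map MarkedWord.word).flatten) = n) →
      ∃ ms : List (MarkedWord α), (∀ x ∈ ms, x ∈ M) ∧
      (ms.IsChain fun a b => b ≠ a.inv) ∧
        FreeGroup.mk ((ms.map MarkedWord.word).flatten) = FreeGroup.mk m.word * n := by
    rintro m hm n ⟨ms, h1, h2, rfl⟩
    cases ms with
    | nil => exact ⟨[m], by simpa using hm, by simp, by simp [mul_mk]⟩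
    | cons m₂ ms =>
      by_cases h : m₂ = m.inv
      · refine ⟨ms, fun x hx => h1 x (List.mem_cons_of_mem _ hx), h2.tail, ?_⟩
        rw [List.map_cons, List.flatten_cons, ← mul_mk, h, MarkedWord.word_inv, ← inv_mk,
          mul_inv_cancel_left]
      · refine ⟨m :: m₂ :: ms, ?_, List.isChain_cons_cons.2 ⟨h, h2⟩, ?_⟩
        · intro x hx
          rcases List.mem_cons.1 hx with rfl | hx
          · exact hm
          · exact h1 x hx
        · rw [mul_mk, List.map_cons, List.flatten_cons]
  induction hn using Subgroup.closure_induction_left with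
  | one => exact ⟨[], by simp, by simp, rfl⟩
  | mul_left x hx y _ ih =>
    obtain ⟨m, hm, rfl⟩ := hx
    exact step m hm y ih
  | inv_mul_cancel x hx y _ ih =>
    obtain ⟨m, hm, rfl⟩ := hx
    rw [inv_mk, ← MarkedWord.word_inv]
    exact step _ (hM.inv_mem m hm) y ih

/-- The shape of the reduced words representing the elements of the subgroup generated by a set of
marked words. -/
theorem normal_form {W : List (α × Bool)} (hW : IsReduced W) (hne : W ≠ [])
    (hN : FreeGroup.mk W ∈ markSubgroup M) :
    (∃ m ∈ M, W = m.word) ∨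
      ∃ m ∈ M, ∃ m' ∈ M, ∃ R, W = m.pre ++ m.letter :: (R ++ m'.letter :: m'.suf) := by
  obtain ⟨ms, h1, h2, h3⟩ := hM.exists_chain hN
  cases ms with
  | nil => exact absurd (eq_of_mk_eq hW IsReduced.nil h3.symm) hne
  | cons m ms =>
    obtain ⟨R, h4, h5, h6⟩ := hM.exists_reduced_chain m ms h1 h2
    have hWR := eq_of_mk_eq hW h5 (h3.symm.trans h4)
    rcases h6 with ⟨-, rfl⟩ | ⟨m', hm', R', rfl⟩
    · exact Or.inl ⟨m, h1 m (by simp), hWR⟩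
    · exact Or.inr ⟨m, h1 m (by simp), m', hm', R', hWR⟩

theorem exists_prefix {W : List (α × Bool)} (hW : IsReduced W) (hne : W ≠ [])
    (hN : FreeGroup.mk W ∈ markSubgroup M) : ∃ m ∈ M, m.pre ++ [m.letter] <+: W := by
  rcases hM.normal_form hW hne hN with ⟨m, hm, rfl⟩ | ⟨m, hm, m', -, R, rfl⟩
  · exact ⟨m, hm, m.prefix_word⟩
  · exact ⟨m, hm, ⟨R ++ m'.letter :: m'.suf, by simp⟩⟩

omit hM in
theorem mem_markTree_of_prefix {t s : List (α × Bool)} (ht : t ∈ markTree M) (h : s <+: t) :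
    s ∈ markTree M := by
  obtain ⟨m, hm, hp⟩ := ht
  exact ⟨m, hm, h.trans hp⟩

theorem markTree_reduced {t : List (α × Bool)} (ht : t ∈ markTree M) : IsReduced t := by
  obtain ⟨m, hm, hp⟩ := ht
  exact isReduced_of_prefix (isReduced_left (hM.reduced m hm)) hp

/-- Such a prefix would lie in the front part of some m', which forces m = m' and makes `m.pre`
longer than itself. -/
theorem not_prefix_of_mem_markTree {m : MarkedWord α} (hm : m ∈ M) {t : List (α × Bool)}
    (ht : t ∈ markTree M) : ¬ m.pre ++ [m.letter] <+: t := by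
  obtain ⟨m', hm', hp⟩ := ht
  intro h
  have h1 := h.trans hp
  obtain rfl := hM.eq_of_prefix hm hm' (h1.trans ((List.prefix_append _ _).trans m'.prefix_word))
  simpa using h1.length_le

theorem length_le_of_prefix {m : MarkedWord α} (hm : m ∈ M) {t W : List (α × Bool)}
    (ht : t ∈ markTree M) (htW : t <+: W) (hmW : m.pre ++ [m.letter] <+: W) :
    t.length ≤ m.pre.length := by
  by_contra hlt
  refine hM.not_prefix_of_mem_markTree hm ht (List.prefix_of_prefix_length_le hmW htW ?_)
  simp; omega

omit hM in
theorem inv_prefix_of_suffix {m : MarkedWord α} {W R : List (α × Bool)}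
    (h : W = R ++ m.letter :: m.suf) : m.inv.pre ++ [m.inv.letter] <+: invRev W := by
  subst h
  exact ⟨invRev R, by simp [MarkedWord.inv, invRev_append, invRev_cons']⟩

/-- Neither g nor h⁻¹ reaches a distinguished letter. If `normal_form` shows two such letters in the
word, both must lie in X. This is used for X of length 0 and 1, where that is impossible. -/
theorem length_le_of_reduced {g h : List (α × Bool)} (hg : g ∈ markTree M) (hh : h ∈ markTree M)
    {X : List (α × Bool)} (hW : IsReduced (g ++ X ++ invRev h)) (hne : g ++ X ++ invRev h ≠ [])
    (hN : FreeGroup.mk (g ++ X ++ invRev h) ∈ markSubgroup M) :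
    (∃ m ∈ M, g ++ X ++ invRev h = m.word ∧ g.length ≤ m.pre.length ∧
      h.length ≤ m.suf.length) ∨ 2 ≤ X.length := by
  have hpre : g <+: g ++ X ++ invRev h := ⟨X ++ invRev h, by simp⟩
  have hpre' : h <+: invRev (g ++ X ++ invRev h) :=
    ⟨invRev (g ++ X), by simp [invRev_append]⟩
  rcases hM.normal_form hW hne hN with ⟨m, hm, hWm⟩ | ⟨m, hm, m', hm', R, hWm⟩
  · refine Or.inl ⟨m, hm, hWm, hM.length_le_of_prefix hm hg hpre (hWm ▸ m.prefix_word), ?_⟩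
    rw [← m.length_inv_pre]
    exact hM.length_le_of_prefix (hM.inv_mem m hm) hh hpre'
      (inv_prefix_of_suffix (m := m) (R := m.pre) hWm)
  · have h1 := hM.length_le_of_prefix hm hg hpre ⟨R ++ m'.letter :: m'.suf, by simp [hWm]⟩
    have h2 := hM.length_le_of_prefix (hM.inv_mem m' hm') hh hpre'
      (inv_prefix_of_suffix (m := m') (R := m.pre ++ m.letter :: R) (by simp [hWm]))
    rw [m'.length_inv_pre] at h2
    have h3 := congrArg List.length hWm
    simp only [List.length_append, invRev_length, List.length_cons] at h3
    right; omega

/-- Distinct words of the tree represent distinct cosets. -/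
theorem markTree_injective {t t' : List (α × Bool)} (ht : t ∈ markTree M) (ht' : t' ∈ markTree M)
    (hN : FreeGroup.mk (t ++ invRev t') ∈ markSubgroup M) : t = t' := by
  obtain ⟨g, c, B, h1, h2, h3⟩ := exists_cancel (hM.markTree_reduced ht)
    (isReduced_invRev (hM.markTree_reduced ht'))
  obtain ⟨h, rfl⟩ : ∃ h, B = invRev h := ⟨invRev B, by simp⟩
  have h4 : t' = h ++ c := by
    apply invRev_injective
    rw [h2, invRev_append]
  rw [h1, h2, mk_append_cancel] at hN
  have hg : g ∈ markTree M := mem_markTree_of_prefix ht ⟨c, h1.symm⟩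
  have hh : h ∈ markTree M := mem_markTree_of_prefix ht' ⟨c, h4.symm⟩
  by_cases hne : g ++ invRev h = []
  · rw [List.append_eq_nil_iff] at hne
    obtain ⟨rfl, hne⟩ := hne
    have : h = [] := by simpa using congrArg List.length hne
    rw [h1, h4, this]
  · exfalso
    -- With X empty, g and h⁻¹ would make up a whole generator without containing its distinguished
    -- letter.
    rcases hM.length_le_of_reduced hg hh (X := []) (by simpa using h3) (by simpa using hne)
      (by simpa using hN) with ⟨m, hm, h5, h6, h7⟩ | h5
    · have h8 := congrArg List.length h5
      rw [m.length_word] at h8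
      simp only [List.append_nil, List.length_append, invRev_length] at h8
      omega
    · simp at h5

/-- Edges between words of the tree in the coset graph are edges of the tree or come from
distinguished letters. -/
theorem markTree_edge {t t' : List (α × Bool)} {x : α × Bool} (ht : t ∈ markTree M)
    (ht' : t' ∈ markTree M) (hN : FreeGroup.mk (t ++ [x] ++ invRev t') ∈ markSubgroup M) :
    t' = t ++ [x] ∨ t = t' ++ [(x.1, !x.2)] ∨
      ∃ m ∈ M, m.pre = t ∧ m.letter = x ∧ m.suf = invRev t' := by
  -- Cancellation to the left of x means that t ends in x⁻¹, cancellation to the right that t' ends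
  -- in x. Without cancellation x is the distinguished letter of a generator.
  by_cases h1 : IsReduced (t ++ [x])
  swap
  · right; left
    rw [isReduced_append_iff] at h1
    push Not at h1
    obtain ⟨a, ha, b, hb, hab⟩ := h1 (hM.markTree_reduced ht) (by simp)
    obtain rfl : x = b := by simpa using hb
    obtain ⟨s, rfl⟩ := List.mem_getLast?_eq_getLast ha |>.elim fun hn h =>
      (⟨t.dropLast, by rw [h, List.dropLast_append_getLast hn]⟩ : ∃ s, t = s ++ [a])
    have hxa : x = (a.1, !a.2) := eq_flip_iff.2 (by tauto)
    subst hxa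
    rw [flip_flip]
    have e : s ++ [a] ++ [(a.1, !a.2)] ++ invRev t' = s ++ [a] ++ (invRev [a] ++ invRev t') := by
      simp [invRev_singleton]
    rw [e, mk_append_cancel] at hN
    rw [hM.markTree_injective (mem_markTree_of_prefix ht (List.prefix_append _ _)) ht' hN]
  by_cases h2 : IsReduced (t ++ [x] ++ invRev t')
  swap
  · left
    rw [isReduced_append_iff] at h2
    push Not at h2
    obtain ⟨a, ha, b, hb, hab⟩ := h2 h1 (isReduced_invRev (hM.markTree_reduced ht'))
    obtain rfl : x = a := by simpa using ha
    obtain ⟨s, hs⟩ : ∃ s, invRev t' = b :: s := List.head?_eq_some_iff.1 hb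
    have hxb : b = (x.1, !x.2) := eq_flip_iff.2 (by tauto)
    have hts : t' = invRev s ++ [x] := by
      rw [← invRev_invRev (L₁ := t'), hs, invRev_cons', hxb, flip_flip]
    have e : t ++ [x] ++ invRev t' = t ++ [x] ++ (invRev [x] ++ invRev (invRev s)) := by
      rw [hts]; simp [invRev_append]
    rw [e, mk_append_cancel] at hN
    rw [hM.markTree_injective ht (mem_markTree_of_prefix ht' ⟨[x], hts.symm⟩) hN, hts]
  right; right
  rcases hM.length_le_of_reduced ht ht' h2 (by simp) hN with ⟨m, hm, h3, h4, h5⟩ | h3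
  · refine ⟨m, hm, ?_⟩
    have h6 := congrArg List.length h3
    rw [m.length_word] at h6
    simp only [List.length_append, invRev_length, List.length_singleton] at h6
    have h7 : m.pre ++ m.letter :: m.suf = t ++ x :: invRev t' := by
      rw [← MarkedWord.word, ← h3]; simp
    obtain ⟨h8, h9⟩ := List.append_inj h7 (by omega)
    simp only [List.cons.injEq] at h9
    exact ⟨h8, h9.1, h9.2⟩
  · simp at h3

/-- The words of the tree represent all cosets of a nontrivial normal subgroup. -/
theorem markTree_surjective [hN : (markSubgroup M).Normal] (hne : markSubgroup M ≠ ⊥)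
    (g : List (α × Bool)) : ∃ t ∈ markTree M, FreeGroup.mk (g ++ invRev t) ∈ markSubgroup M := by
  induction g using List.reverseRecOn with
  | nil =>
    have hMne : M.Nonempty := by
      by_contra h
      rw [Set.not_nonempty_iff_eq_empty] at h
      apply hne
      simp [markSubgroup, h]
    obtain ⟨m, hm⟩ := hMne
    exact ⟨[], ⟨m, hm, List.nil_prefix⟩, (markSubgroup M).one_mem⟩
  | append_singleton g x ih =>
    obtain ⟨t, ht, htN⟩ := ih
    have key : ∀ t', FreeGroup.mk (t ++ [x] ++ invRev t') ∈ markSubgroup M →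
        FreeGroup.mk (g ++ [x] ++ invRev t') ∈ markSubgroup M := by
      intro t' h
      have := (markSubgroup M).mul_mem htN h
      rw [← mul_mk, ← mul_mk, ← mul_mk, ← inv_mk] at this
      rw [← mul_mk, ← mul_mk]
      convert this using 1; group
    by_cases h1 : IsReduced (t ++ [x])
    -- The word t x extends to a reduced word representing an element of the subgroup, which starts
    -- with `m.pre ++ [m.letter]` for some m. As t does not reach this letter, either t x stays in
    -- the tree or t x is exactly this beginning; then m leads on to `m.inv.pre`.
    · obtain ⟨R, hR, hRN⟩ := exists_prefix_mem_normal hne h1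
      obtain ⟨m, hm, hp⟩ := hM.exists_prefix hR (by simp) hRN
      have hle := hM.length_le_of_prefix hm ht ⟨[x] ++ R, by simp⟩ hp
      rcases hle.lt_or_eq with hlt | heq
      · refine ⟨t ++ [x], ⟨m, hm, ?_⟩, key _ ?_⟩
        · exact List.prefix_of_prefix_length_le (List.prefix_append _ R)
            ((List.prefix_append _ _).trans hp) (by simpa using hlt)
        · rw [← mul_mk, ← inv_mk, mul_inv_cancel]; exact (markSubgroup M).one_mem
      · have h2 : m.pre ++ [m.letter] = t ++ [x] := by
          refine List.IsPrefix.eq_of_length ?_ (by simp [heq])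
          exact List.prefix_of_prefix_length_le hp (List.prefix_append _ R) (by simp [heq])
        refine ⟨m.inv.pre, ⟨m.inv, hM.inv_mem m hm, List.prefix_rfl⟩, key _ ?_⟩
        rw [← h2]
        have : m.pre ++ [m.letter] ++ invRev m.inv.pre = m.word := by
          simp [MarkedWord.inv, MarkedWord.word]
        rw [this]
        exact mk_word_mem hm
    · rw [isReduced_append_iff] at h1
      push Not at h1
      obtain ⟨a, ha, b, hb, hab⟩ := h1 (hM.markTree_reduced ht) (by simp)
      obtain rfl : x = b := by simpa using hb
      obtain ⟨s, rfl⟩ := List.mem_getLast?_eq_getLast ha |>.elim fun hn h =>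
        (⟨t.dropLast, by rw [h, List.dropLast_append_getLast hn]⟩ : ∃ s, t = s ++ [a])
      have hxa : x = (a.1, !a.2) := eq_flip_iff.2 (by tauto)
      subst hxa
      refine ⟨s, mem_markTree_of_prefix ht (List.prefix_append _ _), key _ ?_⟩
      have e : s ++ [a] ++ [(a.1, !a.2)] ++ invRev s = s ++ [a] ++ (invRev [a] ++ invRev s) := by
        simp [invRev_singleton]
      rw [e, mk_append_cancel, ← mul_mk, ← inv_mk, mul_inv_cancel]
      exact (markSubgroup M).one_mem

end IsMarking

end Marks

end AutGroup

namespace AutGroup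

open FreeGroup

/-! ### Paths in transducers and balanced loops -/

namespace Transducer

variable {A V : Type*} {T : Transducer A V}

theorem Path.append {p q r : V} {u v u' v' : List A} (h : T.Path p q u v)
    (h' : T.Path q r u' v') : T.Path p r (u ++ u') (v ++ v') := by
  induction h with
  | nil p => exact h'
  | cons p q s a b u v he _ ih =>
    rw [List.append_assoc, List.append_assoc]
    exact Path.cons p q r a b _ _ he (ih h')

theorem Path.single {p q : V} {a b : Option A} (h : T.edge p (a, b) q) :
    T.Path p q a.toList b.toList := by
  simpa using Path.cons p q q a b [] [] h (Path.nil q)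

theorem Path.iterate {p : V} {u v : List A} (h : T.Path p p u v) (n : ℕ) :
    T.Path p p (List.replicate n u).flatten (List.replicate n v).flatten := by
  induction n with
  | zero => exact Path.nil p
  | succ n ih =>
    rw [List.replicate_succ, List.replicate_succ, List.flatten_cons, List.flatten_cons]
    exact h.append ih

/-- A path may be cut after any prefix of its first label. -/
theorem Path.split {p r : V} {u u₁ u₂ v : List A} (h : T.Path p r u v) (hu : u = u₁ ++ u₂) :
    ∃ q v₁ v₂, v = v₁ ++ v₂ ∧ T.Path p q u₁ v₁ ∧ T.Path q r u₂ v₂ := by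
  induction h generalizing u₁ with
  | nil p =>
    obtain ⟨rfl, rfl⟩ := List.append_eq_nil_iff.1 hu.symm
    exact ⟨p, [], [], rfl, Path.nil p, Path.nil p⟩
  | cons p q r a b u v he hp ih =>
    cases u₁ with
    | nil =>
      refine ⟨p, [], _, rfl, Path.nil p, ?_⟩
      rw [List.nil_append] at hu
      rw [← hu]
      exact Path.cons p q r a b u v he hp
    | cons c u₁ =>
      cases a with
      | none =>
        obtain ⟨s, v₁, v₂, rfl, h1, h2⟩ := ih (u₁ := c :: u₁) (by simpa using hu)
        exact ⟨s, b.toList ++ v₁, v₂, by simp, Path.cons p q s none b _ _ he h1, h2⟩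
      | some a =>
        simp only [Option.toList_some, List.cons_append, List.nil_append, List.cons.injEq] at hu
        obtain ⟨s, v₁, v₂, rfl, h1, h2⟩ := ih hu.2
        refine ⟨s, b.toList ++ v₁, v₂, by simp, ?_, h2⟩
        rw [← hu.1]
        exact Path.cons p q s (some a) b _ _ he h1

theorem Path.mono {T' : Transducer A V} (hT : ∀ p l q, T.edge p l q → T'.edge p l q) {p q : V}
    {u v : List A} (h : T.Path p q u v) : T'.Path p q u v := by
  induction h with
  | nil p => exact Path.nil p
  | cons p q r a b u v he _ ih => exact Path.cons p q r a b u v (hT _ _ _ he) ih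

/-- The transducer for the inverse relation. -/
def swap (T : Transducer A V) : Transducer A V where
  edge p l q := T.edge p l.swap q
  initial := T.initial
  terminal := T.terminal

theorem Path.swap {p q : V} {u v : List A} (h : T.Path p q u v) : T.swap.Path p q v u := by
  induction h with
  | nil p => exact Path.nil p
  | cons p q r a b u v he _ ih => exact Path.cons p q r b a v u he ih

theorem path_swap_iff {p q : V} {u v : List A} : T.swap.Path p q u v ↔ T.Path p q v u :=
  ⟨fun h => h.swap, fun h => h.swap⟩

theorem mem_accepts_swap {x : List A × List A} : x ∈ T.swap.accepts ↔ x.swap ∈ T.accepts := by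
  simp only [accepts, Set.mem_ofPred_eq, path_swap_iff]
  rfl

/-- A terminal vertex can be reached from `s`. -/
def Coaccessible (T : Transducer A V) (s : V) : Prop :=
  ∃ q ∈ T.terminal, ∃ r t, T.Path s q r t

/-- The vertex `s` can be reached from the initial vertex. -/
def Accessible (T : Transducer A V) (s : V) : Prop := ∃ r t, T.Path T.initial s r t

theorem Coaccessible.of_path {p q : V} {u v : List A} (hq : T.Coaccessible q)
    (h : T.Path p q u v) : T.Coaccessible p := by
  obtain ⟨f, hf, r, t, h'⟩ := hq
  exact ⟨f, hf, _, _, h.append h'⟩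

theorem Accessible.of_path {p q : V} {u v : List A} (hp : T.Accessible p)
    (h : T.Path p q u v) : T.Accessible q := by
  obtain ⟨r, t, h'⟩ := hp
  exact ⟨_, _, h'.append h⟩

/-- One completion is chosen for each of the finitely many vertices. It serves to replace an unknown
continuation of a path by a short one. -/
theorem exists_bounded_completion [Finite V] (T : Transducer A V) :
    ∃ K : ℕ, ∀ s, T.Coaccessible s →
      ∃ q ∈ T.terminal, ∃ r t, T.Path s q r t ∧ r.length + t.length ≤ K := by
  classical
  have h : ∀ s, ∃ k : ℕ, T.Coaccessible s →
      ∃ q ∈ T.terminal, ∃ r t, T.Path s q r t ∧ r.length + t.length ≤ k := by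
    intro s
    by_cases hs : T.Coaccessible s
    · obtain ⟨q, hq, r, t, h⟩ := hs
      exact ⟨_, fun _ => ⟨q, hq, r, t, h, le_rfl⟩⟩
    · exact ⟨0, fun h => absurd h hs⟩
  choose k hk using h
  obtain ⟨K, hK⟩ := (Set.finite_range k).bddAbove
  refine ⟨K, fun s hs => ?_⟩
  obtain ⟨q, hq, r, t, h, hle⟩ := hk s hs
  exact ⟨q, hq, r, t, h, hle.trans (hK ⟨s, rfl⟩)⟩

/-- The transducer with only those edges which start in `S`. -/
def restrict (T : Transducer A V) (S : Set V) : Transducer A V where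
  edge p l q := p ∈ S ∧ T.edge p l q
  initial := T.initial
  terminal := T.terminal

theorem Path.of_restrict {S : Set V} {p q : V} {u v : List A} (h : (T.restrict S).Path p q u v) :
    T.Path p q u v := Path.mono (T := T.restrict S) (fun _ _ _ h => h.2) h

/-- Decomposition of a path at the last edge which starts in `s`. -/
theorem Path.last_visit {S : Set V} (s : V) {p r : V} {u v : List A}
    (h : (T.restrict S).Path p r u v) :
    (T.restrict (S \ {s})).Path p r u v ∨
      ∃ u₁ v₁ a b q u₂ v₂, T.Path p s u₁ v₁ ∧ T.edge s (a, b) q ∧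
        (T.restrict (S \ {s})).Path q r u₂ v₂ ∧ u = u₁ ++ (a.toList ++ u₂) ∧
        v = v₁ ++ (b.toList ++ v₂) := by
  induction h with
  | nil p => exact Or.inl (Path.nil p)
  | cons p q r a b u v he _ ih =>
    rcases ih with ih | ⟨u₁, v₁, a', b', q', u₂, v₂, h1, h2, h3, rfl, rfl⟩
    · by_cases hp : p = s
      · subst hp
        exact Or.inr ⟨[], [], a, b, q, u, v, Path.nil p, he.2, ih, rfl, rfl⟩
      · exact Or.inl (Path.cons p q r a b u v ⟨⟨he.1, hp⟩, he.2⟩ ih)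
    · exact Or.inr ⟨_, _, a', b', q', u₂, v₂, Path.cons p q s a b u₁ v₁ he.2 h1, h2, h3,
        by simp, by simp⟩

/-- If the two labels of every loop have the same length, then the lengths of the two labels of
any path differ by a bounded amount. -/
theorem length_diff_le [Finite V]
    (hloop : ∀ s, T.Accessible s → T.Coaccessible s → ∀ x y, T.Path s s x y →
      x.length = y.length) :
    ∃ K : ℕ, ∀ p q, T.Accessible p → T.Coaccessible q → ∀ u v, T.Path p q u v →
      u.length ≤ v.length + K ∧ v.length ≤ u.length + K := by
  classical
  have := Fintype.ofFinite V
  -- Induction on the number of vertices where edges may start: up to the last edge starting at p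
  -- the path is a balanced loop, this edge contributes at most 1, and the rest has no edge starting
  -- at p.
  have key : ∀ n : ℕ, ∀ S : Finset V, S.card = n → ∀ p q, T.Accessible p → T.Coaccessible q →
      ∀ u v, (T.restrict S).Path p q u v → u.length ≤ v.length + n ∧ v.length ≤ u.length + n := by
    intro n
    induction n with
    | zero =>
      intro S hS p q _ _ u v h
      rw [Finset.card_eq_zero] at hS
      subst hS
      cases h with
      | nil => simp
      | cons p q r a b u v he => simp [restrict] at he
    | succ n ih =>
      intro S hS p q hp hq u v h
      by_cases hpS : p ∈ S
      · have hcard : (S.erase p).card = n := by rw [Finset.card_erase_of_mem hpS, hS]; rfl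
        rcases h.last_visit p with h' | ⟨u₁, v₁, a, b, q', u₂, v₂, h1, h2, h3, rfl, rfl⟩
        · rw [← Finset.coe_erase] at h'
          have := ih _ hcard p q hp hq u v h'
          omega
        · rw [← Finset.coe_erase] at h3
          have e1 := hloop p hp (hq.of_path h.of_restrict) _ _ h1
          have e2 := ih _ hcard q' q (hp.of_path (Path.single h2)) hq _ _ h3
          have e3 : a.toList.length ≤ 1 := by cases a <;> simp
          have e4 : b.toList.length ≤ 1 := by cases b <;> simp
          simp only [List.length_append]
          omega
      · cases h with
        | nil => simp
        | cons p q r a b u v he => exact absurd he.1 (by simpa using hpS)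
  refine ⟨Fintype.card V, fun p q hp hq u v h => ?_⟩
  refine key _ Finset.univ rfl p q hp hq u v (h.mono (T' := T.restrict _) fun p l q h => ⟨by simp, h⟩)

end Transducer

/-! ### Pumping: significant letters force synchronization -/

section Significant

variable {α : Type*}

/-- The language of inverses of the words of `L`. -/
def invLanguage (L : Language (α × Bool)) : Language (α × Bool) := {w | invRev w ∈ L}

/-- The distinguished letters of the inverses. -/
def invMark (d : List (α × Bool) → MarkedWord α) : List (α × Bool) → MarkedWord α :=
  fun w => (d (invRev w)).inv

theorem mem_invLanguage {L : Language (α × Bool)} {w : List (α × Bool)} :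
    w ∈ invLanguage L ↔ invRev w ∈ L := Iff.rfl

theorem signed_invMark (d : List (α × Bool) → MarkedWord α) (w : List (α × Bool)) (ε : Bool) :
    (invMark d w).signed ε = (d (invRev w)).signed (!ε) := by
  cases ε <;> simp [invMark, MarkedWord.signed, MarkedWord.inv_inv]

variable {L : Language (α × Bool)} {d : List (α × Bool) → MarkedWord α}

theorem IsSignificant.inverse (h : IsSignificant L d) :
    IsSignificant (invLanguage L) (invMark d) where
  ne_nil w hw h0 := h.ne_nil _ hw (by simp [h0])
  reduced w hw := by simpa using isReduced_invRev (h.reduced _ hw)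
  word_eq w hw := by
    rw [invMark, MarkedWord.word_inv, h.word_eq _ hw, invRev_invRev]
  significant w₁ h₁ w₂ h₂ ε₁ ε₂ := by
    rw [signed_invMark, signed_invMark]
    exact h.significant _ h₁ _ h₂ _ _

theorem distCenter_inv (m : MarkedWord α) : m.inv.distCenter = m.distCenter := by
  unfold MarkedWord.distCenter
  rw [m.inv.length_word, m.length_word, m.length_inv_pre]
  have : m.inv.suf.length = m.pre.length := by simp [MarkedWord.inv]
  rw [this, ← abs_neg]
  congr 1
  push_cast
  ring

/-- For finite L the bound n may exceed the lengths of all words. -/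
theorem IsOCentral.eventually (h : IsOCentral L d) :
    ∀ c : ℝ, 0 < c → ∃ n : ℕ, ∀ w ∈ L, n ≤ w.length → (d w).distCenter ≤ c * (w.length : ℝ) := by
  rcases h with h | h
  · intro c _
    obtain ⟨K, hK⟩ := (h.image List.length).bddAbove
    refine ⟨K + 1, fun w hw hlen => ?_⟩
    have := hK ⟨w, hw, rfl⟩
    omega
  · exact h

theorem IsOCentral.inverse (h : IsOCentral L d) : IsOCentral (invLanguage L) (invMark d) := by
  right
  intro c hc
  obtain ⟨n, hn⟩ := h.eventually c hc
  refine ⟨n, fun w hw hlen => ?_⟩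
  rw [invMark, distCenter_inv]
  simpa using hn _ hw (by simpa using hlen)

/-- Significance is applied to w₁⁻¹ w₂, where a common beginning through the letter of w₁ would
cancel it. -/
theorem IsSignificant.eq_of_prefix (h : IsSignificant L d) {w₁ w₂ : List (α × Bool)}
    (h₁ : w₁ ∈ L) (h₂ : w₂ ∈ L) (hp : (d w₁).pre ++ [(d w₁).letter] <+: w₂) : w₁ = w₂ := by
  by_contra hne
  have hs := h.significant w₁ h₁ w₂ h₂ false true
  simp only [MarkedWord.signed, Bool.false_eq_true, if_false, if_true, MarkedWord.word_inv,
    h.word_eq _ h₁, h.word_eq _ h₂] at hs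
  refine (hs ?_).not_prefix ?_ ?_ (by rwa [h.word_eq _ h₂])
  · intro hred
    apply hne
    apply eq_of_mk_eq (h.reduced _ h₁) (h.reduced _ h₂)
    have : FreeGroup.mk (invRev w₁ ++ w₂) = 1 := Red.exact.2 ⟨[], hred, .refl⟩
    rw [← mul_mk, ← inv_mk] at this
    exact inv_mul_eq_one.1 this
  · rw [h.word_eq _ h₁]; exact h.reduced _ h₁
  · rw [h.word_eq _ h₂]; exact h.reduced _ h₂

variable {V : Type*} {T : Transducer (α × Bool) V}

/-- `L` consists of the words `u v⁻¹` with `(u, v)` accepted by `T`. -/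
def IsFolding (T : Transducer (α × Bool) V) (L : Language (α × Bool)) : Prop :=
  ∀ w, w ∈ L ↔ ∃ x ∈ T.accepts, w = x.1 ++ invRev x.2

/-- Inversion of words exchanges the two labels, so results on first labels have mirror images for
second labels. -/
theorem IsFolding.inverse (h : IsFolding T L) : IsFolding T.swap (invLanguage L) := by
  intro w
  rw [mem_invLanguage, h]
  constructor
  · rintro ⟨x, hx, hw⟩
    refine ⟨x.swap, Transducer.mem_accepts_swap.2 (by simpa using hx), ?_⟩
    rw [← invRev_invRev (L₁ := w), hw]
    simp [invRev_append]
  · rintro ⟨x, hx, hw⟩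
    refine ⟨x.swap, Transducer.mem_accepts_swap.1 hx, ?_⟩
    rw [hw]
    simp [invRev_append]

theorem IsFolding.mem (h : IsFolding T L) {s q : V} {u v r t : List (α × Bool)}
    (h₁ : T.Path T.initial s u v) (hq : q ∈ T.terminal) (h₂ : T.Path s q r t) :
    (u ++ r) ++ invRev (v ++ t) ∈ L := (h _).2 ⟨(_, _), ⟨q, hq, h₁.append h₂⟩, rfl⟩

/-- If x were longer than y, pumping would push the center, and with it the significant letter, into
p xⁱ. This is also a prefix of the next pumped word, so two words of different lengths would
coincide. -/
theorem loop_length_le (hT : IsFolding T L) (hs : IsSignificant L d) (ho : IsOCentral L d)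
    {s : V} (ha : T.Accessible s) (hc : T.Coaccessible s) {x y : List (α × Bool)}
    (hl : T.Path s s x y) : x.length ≤ y.length := by
  by_contra hlt
  push Not at hlt
  obtain ⟨p, q, h1⟩ := ha
  obtain ⟨f, hf, r, t, h2⟩ := hc
  set w : ℕ → List (α × Bool) := fun i =>
    (p ++ (List.replicate i x).flatten ++ r) ++ invRev (q ++ (List.replicate i y).flatten ++ t)
    with hw
  have hwL : ∀ i, w i ∈ L := fun i => hT.mem (h1.append (hl.iterate i)) hf h2
  have hlen : ∀ i, (w i).length =
      p.length + q.length + r.length + t.length + i * (x.length + y.length) := by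
    intro i
    simp only [hw, List.length_append, invRev_length, List.length_flatten, List.map_replicate,
      List.sum_replicate, smul_eq_mul]
    ring
  -- With this constant the letter is within P + i/4 of the center, which itself lies i/2 before
  -- position i |x|, up to constants.
  obtain ⟨n, hn⟩ := ho.eventually (1 / (4 * (x.length + y.length))) (by
    have : (0 : ℝ) < x.length := by exact_mod_cast (by omega)
    positivity)
  set P := p.length + q.length + r.length + t.length with hP
  -- Now i/4 outweighs the constant terms 3P/2 + 1/2, and the summand n makes the word long enough.
  set i := 8 * P + 8 + n with hi
  have hni : n ≤ (w i).length := by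
    rw [hlen]
    have : 1 ≤ x.length + y.length := by omega
    nlinarith
  have hd := hn _ (hwL i) hni
  have hpre : (d (w i)).pre.length + 1 ≤ i * x.length := by
    rw [MarkedWord.distCenter, hs.word_eq _ (hwL i)] at hd
    have h3 := (abs_le.1 hd).2
    have h4 : ((w i).length : ℝ) = P + i * (x.length + y.length) := by
      rw [hlen]; push_cast; ring
    have hX : (y.length : ℝ) + 1 ≤ x.length := by exact_mod_cast hlt
    have hY : (0 : ℝ) ≤ y.length := by positivity
    have hXY : (1 : ℝ) ≤ x.length + y.length := by linarith
    have hP0 : (0 : ℝ) ≤ P := by positivity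
    have hiP : (i : ℝ) = 8 * P + 8 + n := by rw [hi]; push_cast; ring
    have h5 : 1 / (4 * ((x.length : ℝ) + y.length)) * (P + i * (x.length + y.length)) ≤
        P + i / 4 := by
      have : 1 / (4 * ((x.length : ℝ) + y.length)) * (P + i * (x.length + y.length)) =
          P * (1 / (4 * ((x.length : ℝ) + y.length))) + i / 4 := by
        field_simp
      rw [this]
      have : 1 / (4 * ((x.length : ℝ) + y.length)) ≤ 1 := by
        rw [div_le_one (by linarith)]; linarith
      nlinarith
    rw [h4] at h3
    have hn0 : (0 : ℝ) ≤ n := by positivity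
    have hi0 : (0 : ℝ) ≤ i := by positivity
    have h6 : (i : ℝ) * (x.length + y.length) ≤ i * (2 * x.length - 1) :=
      mul_le_mul_of_nonneg_left (by linarith) hi0
    have h7 : (((d (w i)).pre.length + 1 : ℕ) : ℝ) ≤ i * x.length := by
      linarith
    exact_mod_cast h7
  have hp1 : (d (w i)).pre ++ [(d (w i)).letter] <+: p ++ (List.replicate i x).flatten := by
    have ha : (d (w i)).pre ++ [(d (w i)).letter] <+: w i := by
      have := (d (w i)).prefix_word
      rwa [hs.word_eq _ (hwL i)] at this
    refine List.prefix_of_prefix_length_le ha ?_ ?_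
    · simp only [hw, List.append_assoc]
      rw [← List.append_assoc]
      exact List.prefix_append _ _
    · simp only [List.length_append, List.length_singleton, List.length_flatten,
        List.map_replicate, List.sum_replicate, smul_eq_mul]
      omega
  have hp2 : p ++ (List.replicate i x).flatten <+: w (i + 1) := by
    simp only [hw, List.replicate_succ', List.flatten_append, List.append_assoc]
    rw [← List.append_assoc p]
    exact List.prefix_append _ _
  have heq := congrArg List.length (hs.eq_of_prefix (hwL i) (hwL (i + 1)) (hp1.trans hp2))
  have hsucc : (i + 1) * (x.length + y.length) = i * (x.length + y.length) +
      (x.length + y.length) := by ring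
  rw [hlen, hlen, hsucc] at heq
  omega

theorem loop_length_eq (hT : IsFolding T L) (hs : IsSignificant L d) (ho : IsOCentral L d)
    {s : V} (ha : T.Accessible s) (hc : T.Coaccessible s) {x y : List (α × Bool)}
    (hl : T.Path s s x y) : x.length = y.length := by
  refine le_antisymm (loop_length_le hT hs ho ha hc hl) ?_
  refine loop_length_le hT.inverse hs.inverse ho.inverse (s := s) ?_ ?_ hl.swap
  · obtain ⟨r, t, h⟩ := ha
    exact ⟨t, r, h.swap⟩
  · obtain ⟨q, hq, r, t, h⟩ := hc
    exact ⟨q, hq, t, r, h.swap⟩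

/-- The two labels of an initial segment of a successful path have almost the same length. -/
theorem exists_balance [Finite V] (hT : IsFolding T L) (hs : IsSignificant L d)
    (ho : IsOCentral L d) :
    ∃ K : ℕ, ∀ q, T.Coaccessible q → ∀ u v, T.Path T.initial q u v →
      u.length ≤ v.length + K ∧ v.length ≤ u.length + K := by
  obtain ⟨K, hK⟩ := Transducer.length_diff_le (T := T)
    fun s ha hc x y hl => loop_length_eq hT hs ho ha hc hl
  exact ⟨K, fun q hq u v h => hK _ q ⟨[], [], Transducer.Path.nil _⟩ hq u v h⟩

theorem isSynchronized_of_isFolding [Finite V] (hT : IsFolding T L) (hs : IsSignificant L d)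
    (ho : IsOCentral L d) : IsSynchronized T.accepts := by
  obtain ⟨K, hK⟩ := exists_balance hT hs ho
  refine ⟨K, ?_⟩
  rintro ⟨u, v⟩ ⟨q, hq, h⟩
  exact hK q ⟨q, hq, [], [], Transducer.Path.nil q⟩ u v h

end Significant

end AutGroup

namespace AutGroup

open FreeGroup

/-! ### Bounded centrality and fellow traveling -/

section FellowTravel

variable {α : Type*}

/-- The words `g` and `h` represent elements of the quotient by `N` at distance at most `k`. -/
def NearMod (N : Subgroup (FreeGroup α)) (k : ℕ) (g h : List (α × Bool)) : Prop :=
  ∃ x : List (α × Bool), x.length ≤ k ∧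
    (QuotientGroup.mk (FreeGroup.mk (g ++ x)) : FreeGroup α ⧸ N) =
      QuotientGroup.mk (FreeGroup.mk h)

namespace NearMod

variable {N : Subgroup (FreeGroup α)}

theorem mono {k l : ℕ} {g h : List (α × Bool)} (hgh : NearMod N k g h) (hkl : k ≤ l) :
    NearMod N l g h := by
  obtain ⟨x, hx, h⟩ := hgh
  exact ⟨x, hx.trans hkl, h⟩

variable [N.Normal]

theorem trans {k l : ℕ} {g h i : List (α × Bool)} (h₁ : NearMod N k g h) (h₂ : NearMod N l h i) :
    NearMod N (k + l) g i := by
  obtain ⟨x, hx, h₁⟩ := h₁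
  obtain ⟨y, hy, h₂⟩ := h₂
  refine ⟨x ++ y, by simp; omega, ?_⟩
  rw [← List.append_assoc, ← mul_mk, QuotientGroup.mk_mul, h₁, ← QuotientGroup.mk_mul, mul_mk, h₂]

theorem symm {k : ℕ} {g h : List (α × Bool)} (h₁ : NearMod N k g h) : NearMod N k h g := by
  obtain ⟨x, hx, h₁⟩ := h₁
  refine ⟨invRev x, by simpa using hx, ?_⟩
  rw [← mul_mk, QuotientGroup.mk_mul, ← h₁, ← QuotientGroup.mk_mul, ← mul_mk, ← inv_mk,
    mul_inv_cancel_right]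

omit [N.Normal] in
theorem of_prefix_prefix {k : ℕ} {g h : List (α × Bool)} (hgh : g <+: h)
    (hk : h.length ≤ g.length + k) : NearMod N k g h := by
  obtain ⟨x, rfl⟩ := hgh
  exact ⟨x, by simp at hk; omega, rfl⟩

theorem of_prefix {k : ℕ} {g h w : List (α × Bool)} (hg : g <+: w) (hh : h <+: w)
    (h₁ : g.length ≤ h.length + k) (h₂ : h.length ≤ g.length + k) : NearMod N k g h := by
  rcases List.prefix_or_prefix_of_prefix hg hh with hp | hp
  · exact of_prefix_prefix hp h₂
  · exact (of_prefix_prefix hp h₁).symm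

end NearMod

variable {L : Language (α × Bool)} {d : List (α × Bool) → MarkedWord α}
variable {V : Type*} {T : Transducer (α × Bool) V}

/-- Cut a successful path just behind the significant letter and complete it by a bounded path. The
new word agrees with w through this letter, so it is w, whose length is thereby at most twice that
of the cut first label, up to a constant. If the first label does not reach beyond the letter,
balance alone suffices. -/
theorem exists_length_le_pre [Finite V] (hT : IsFolding T L) (hs : IsSignificant L d)
    (ho : IsOCentral L d) : ∃ K : ℕ, ∀ w ∈ L, w.length ≤ 2 * (d w).pre.length + K := by
  obtain ⟨K₁, hK₁⟩ := exists_balance hT hs ho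
  obtain ⟨K₂, hK₂⟩ := T.exists_bounded_completion
  refine ⟨K₁ + K₂ + 2, fun w hw => ?_⟩
  obtain ⟨⟨u, v⟩, ⟨f, hf, hpath⟩, hwx⟩ := (hT w).1 hw
  simp only at hpath hwx
  have hc : T.Coaccessible f := ⟨f, hf, [], [], .nil f⟩
  have hb := hK₁ f hc u v hpath
  have hlen := congrArg List.length hwx
  simp only [List.length_append, invRev_length] at hlen
  have hmw : (d w).pre ++ [(d w).letter] <+: w := by
    have := (d w).prefix_word
    rwa [hs.word_eq _ hw] at this
  have huw : u <+: w := ⟨invRev v, hwx.symm⟩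
  rcases List.prefix_or_prefix_of_prefix hmw huw with ⟨u', hu'⟩ | hp
  · obtain ⟨s, v₁, v₂, -, h1, h2⟩ := hpath.split hu'.symm
    have hcs := hc.of_path h2
    have hbs := hK₁ s hcs _ _ h1
    obtain ⟨q, hq, r, t, h3, h4⟩ := hK₂ s hcs
    have hw' := hT.mem h1 hq h3
    have heq := congrArg List.length
      (hs.eq_of_prefix hw hw' ⟨r ++ invRev (v₁ ++ t), by simp⟩)
    simp only [List.length_append, invRev_length, List.length_singleton] at heq hbs
    omega
  · have := hp.length_le
    simp only [List.length_append, List.length_singleton] at this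
    omega

/-- Distinguished letters are within bounded distance of the center. -/
theorem exists_length_le_pre_suf [Finite V] (hT : IsFolding T L) (hs : IsSignificant L d)
    (ho : IsOCentral L d) : ∃ K : ℕ, ∀ w ∈ L, w.length ≤ 2 * (d w).pre.length + K ∧
      w.length ≤ 2 * (d w).suf.length + K := by
  obtain ⟨K₁, hK₁⟩ := exists_length_le_pre hT hs ho
  obtain ⟨K₂, hK₂⟩ := exists_length_le_pre hT.inverse hs.inverse ho.inverse
  refine ⟨K₁ + K₂, fun w hw => ⟨by have := hK₁ w hw; omega, ?_⟩⟩
  have := hK₂ (invRev w) (by rw [mem_invLanguage, invRev_invRev]; exact hw)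
  rw [invMark, invRev_invRev, (d w).length_inv_pre, invRev_length] at this
  omega

/-- The words `u` and `v` of an accepted pair fellow travel asynchronously. -/
theorem exists_near_prefix [Finite V] {N : Subgroup (FreeGroup α)} [N.Normal]
    (hT : IsFolding T L) (hs : IsSignificant L d)
    (ho : IsOCentral L d) (hN : ∀ w ∈ L, FreeGroup.mk w ∈ N) :
    ∃ K : ℕ, ∀ x ∈ T.accepts, ∀ p, p <+: x.1 → ∃ q, q <+: x.2 ∧ p.length ≤ q.length + K ∧
      q.length ≤ p.length + K ∧ NearMod N K p q := by
  obtain ⟨K₁, hK₁⟩ := exists_balance hT hs ho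
  obtain ⟨K₂, hK₂⟩ := T.exists_bounded_completion
  refine ⟨K₁ + K₂, ?_⟩
  rintro ⟨u, v⟩ ⟨f, hf, hpath⟩ p ⟨u', hu'⟩
  obtain ⟨s, v₁, v₂, hv, h1, h2⟩ := hpath.split hu'.symm
  have hcs : T.Coaccessible s := ⟨f, hf, _, _, h2⟩
  have hb := hK₁ s hcs _ _ h1
  -- As p r (v₁ t)⁻¹ represents an element of N, the short word r t⁻¹ leads from p to v₁ in the
  -- quotient.
  obtain ⟨q, hq, r, t, h3, h4⟩ := hK₂ s hcs
  refine ⟨v₁, ⟨v₂, hv.symm⟩, by omega, by omega, r ++ invRev t, by simp; omega, ?_⟩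
  have hmem := hN _ (hT.mem h1 hq h3)
  rw [eq_comm, QuotientGroup.eq]
  have := ‹N.Normal›.conj_mem _ hmem (FreeGroup.mk v₁)⁻¹
  rw [inv_inv, inv_mk, mul_mk, mul_mk] at this
  rw [inv_mk, mul_mk]
  convert this using 1
  rw [invRev_append, ← mul_mk, ← mul_mk, ← mul_mk, ← mul_mk, ← mul_mk, ← mul_mk, ← mul_mk,
    ← mul_mk, ← inv_mk, ← inv_mk]
  group

/-- An accepted pair and the significant letter both cut w near its center, so prefixes on either
side may be exchanged for each other at bounded cost. Fellow traveling becomes synchronous since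
matched prefixes have almost equal lengths. -/
theorem exists_syncFellowTravel [Finite V] {N : Subgroup (FreeGroup α)} [N.Normal]
    (hT : IsFolding T L) (hs : IsSignificant L d) (ho : IsOCentral L d)
    (hN : ∀ w ∈ L, FreeGroup.mk w ∈ N) :
    ∃ k : ℕ, ∀ w ∈ L, SyncFellowTravel N k (d w).pre (invRev (d w).suf) := by
  obtain ⟨K₁, hK₁⟩ := isSynchronized_of_isFolding hT hs ho
  obtain ⟨K₂, hK₂⟩ := exists_length_le_pre_suf hT hs ho
  obtain ⟨K₃, hK₃⟩ := exists_near_prefix hT hs ho hN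
  refine ⟨(K₁ + K₂) + K₃ + (K₃ + K₁ + K₂), fun w hw t => ?_⟩
  obtain ⟨⟨u, v⟩, hx, hwx⟩ := (hT w).1 hw
  have hb := hK₁ _ hx
  have hc := hK₂ w hw
  have hlen := congrArg List.length hwx
  have hlen' := (d w).length_word
  have hwd := hs.word_eq w hw
  rw [hwd] at hlen'
  simp only [List.length_append, invRev_length] at hlen hb
  simp only at hwx
  have huw : u <+: w := ⟨invRev v, hwx.symm⟩
  have hvw : v <+: invRev w := ⟨invRev u, by rw [hwx]; simp [invRev_append]⟩
  have hpw : (d w).pre <+: w := ⟨(d w).letter :: (d w).suf, hwd⟩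
  have hsw : invRev (d w).suf <+: invRev w :=
    ⟨invRev ((d w).pre ++ [(d w).letter]), by
      rw [← invRev_append]
      nth_rewrite 4 [← hwd]
      simp [MarkedWord.word]⟩
  -- The minimum is taken because the front part of w stands still from time `(d w).pre.length` on.
  obtain ⟨q, hq, h1, h2, h3⟩ := hK₃ _ hx (u.take (min t (d w).pre.length)) (List.take_prefix _ _)
  simp only at hq
  rw [List.length_take] at h1 h2
  refine (NearMod.trans (NearMod.of_prefix ((List.take_prefix _ _).trans hpw)
    ((List.take_prefix _ _).trans huw) ?_ ?_) h3).trans (NearMod.of_prefix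
      (hq.trans hvw) ((List.take_prefix _ _).trans hsw) ?_ ?_)
  all_goals
    simp only [List.length_take, invRev_length]
    omega

end FellowTravel

end AutGroup

namespace AutGroup

open scoped Pointwise

/-! ### Regular languages from finite invariants; padded pairs -/

section Regularity

/-- A language is regular if its left quotients are determined by an invariant with finitely many
values. -/
theorem isRegular_of_invariant {A S : Type*} [Finite S] {L : Language A} (f : List A → S)
    (h : ∀ x y, f x = f y → ∀ z, x ++ z ∈ L → y ++ z ∈ L) : L.IsRegular := by
  apply Language.IsRegular.of_finite_range_leftQuotient
  have hfac : ∀ x y, f x = f y → L.leftQuotient x = L.leftQuotient y := fun x y hxy =>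
    Set.ext fun z => ⟨h x y hxy z, h y x hxy.symm z⟩
  have hrange : Set.range L.leftQuotient ⊆
      Set.range fun s : Set.range f => L.leftQuotient s.2.choose := by
    rintro _ ⟨x, rfl⟩
    exact ⟨⟨f x, x, rfl⟩, hfac _ _ (Exists.choose_spec (⟨x, rfl⟩ : f x ∈ Set.range f))⟩
  exact (Set.finite_range _).subset hrange

theorem leftQuotient_congr {A : Type*} {L : Language A} {x y z : List A}
    (h : L.leftQuotient x = L.leftQuotient y) : x ++ z ∈ L ↔ y ++ z ∈ L := by
  rw [← Language.mem_leftQuotient, h, Language.mem_leftQuotient]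

variable {A : Type*}

theorem pad_append {u₁ u₂ v₁ v₂ : List A} (hu : u₁.length < v₁.length → u₂ = [])
    (hv : v₁.length < u₁.length → v₂ = []) :
    pad (u₁ ++ u₂) (v₁ ++ v₂) = pad u₁ v₁ ++ pad u₂ v₂ := by
  induction u₁ generalizing v₁ with
  | nil =>
    cases v₁ with
    | nil => simp [pad]
    | cons b v₁ => simp [pad, hu]
  | cons a u₁ ih =>
    cases v₁ with
    | nil => simp [pad, hv]
    | cons b v₁ =>
      have := ih (v₁ := v₁) (fun h => hu (by simpa using h)) (fun h => hv (by simpa using h))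
      simpa [pad] using this

theorem length_pad (u v : List A) : (pad u v).length = max u.length v.length := by
  induction u generalizing v with
  | nil => simp [pad]
  | cons a u ih =>
    cases v with
    | nil => simp [pad]
    | cons b v => simpa [pad] using ih v

theorem pad_take_drop (n : ℕ) (u v : List A) :
    pad u v = pad (u.take n) (v.take n) ++ pad (u.drop n) (v.drop n) := by
  rw [← pad_append, List.take_append_drop, List.take_append_drop]
  · intro h
    rw [List.length_take, List.length_take] at h
    exact List.drop_eq_nil_of_le (by omega)
  · intro h
    rw [List.length_take, List.length_take] at h
    exact List.drop_eq_nil_of_le (by omega)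

theorem pad_fst (u v : List A) : ((pad u v).map Prod.fst).reduceOption = u := by
  induction u generalizing v with
  | nil => simp [pad, List.reduceOption]
  | cons a u ih =>
    cases v with
    | nil => simp [pad, List.reduceOption]
    | cons b v =>
      have := ih v
      simpa [pad] using this

theorem pad_snd (u v : List A) : ((pad u v).map Prod.snd).reduceOption = v := by
  induction v generalizing u with
  | nil => simp [pad, List.reduceOption]
  | cons b v ih =>
    cases u with
    | nil => simp [pad, List.reduceOption]
    | cons a u =>
      have := ih u
      simpa [pad] using this

theorem pad_eq_append {u v : List A} {z s : List (Option A × Option A)} (h : pad u v = z ++ s) :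
    z = pad (u.take z.length) (v.take z.length) ∧ s = pad (u.drop z.length) (v.drop z.length) := by
  rw [pad_take_drop z.length] at h
  refine List.append_inj h.symm ?_
  have := congrArg List.length h
  rw [← pad_take_drop, List.length_append, length_pad] at this
  rw [length_pad, List.length_take, List.length_take]
  omega

theorem mul_eq_mul_of_inv_mul_eq {G : Type*} [Group G] {a a' b c c' d g : G}
    (h : a * b * g = c * d) (h' : a⁻¹ * c = a'⁻¹ * c') : a' * b * g = c' * d := by
  have h1 : b * g = a'⁻¹ * c' * d := by rw [← h', mul_assoc, ← h]; group
  rw [mul_assoc, h1]; group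

variable {G : Type*} [Group G] (p : A → G)

theorem eval_append (u v : List A) : eval p (u ++ v) = eval p u * eval p v := by
  simp [eval]

/-- The pairs of words of a language which are related by right multiplication with a fixed element
and fellow travel form a regular language. -/
theorem isRegular_multiplier {C : Language A} (hC : C.IsRegular) (g : G) {B : Set G}
    (hB : B.Finite) (hFT : ∀ u ∈ C, ∀ v ∈ C, eval p u * g = eval p v →
      ∀ n, (eval p (u.take n))⁻¹ * eval p (v.take n) ∈ B) :
    Language.IsRegular ({z | ∃ u ∈ C, ∃ v ∈ C, eval p u * g = eval p v ∧ z = pad u v} :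
      Language (Option A × Option A)) := by
  classical
  have := hC.finite_range_leftQuotient.to_subtype
  have := hB.to_subtype
  let fs : List (Option A × Option A) → List A := fun z => (z.map Prod.fst).reduceOption
  let sn : List (Option A × Option A) → List A := fun z => (z.map Prod.snd).reduceOption
  -- The invariant consists of the left quotients for both words, the information which of them has
  -- already ended, and their difference in the finite set B.
  let f : List (Option A × Option A) →
      Option (Set.range C.leftQuotient × Set.range C.leftQuotient × Prop × Prop × B) := fun z =>
    if h : z = pad (fs z) (sn z) ∧ (eval p (fs z))⁻¹ * eval p (sn z) ∈ B then
      some (⟨C.leftQuotient (fs z), fs z, rfl⟩, ⟨C.leftQuotient (sn z), sn z, rfl⟩,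
        (fs z).length < (sn z).length, (sn z).length < (fs z).length, ⟨_, h.2⟩)
    else none
  refine isRegular_of_invariant f ?_
  rintro z z' hf s ⟨u, hu, v, hv, huv, hz⟩
  obtain ⟨hz1, hz2⟩ := pad_eq_append hz.symm
  set n := z.length
  have hfs : fs z = u.take n := by simp only [fs]; rw [hz1, pad_fst]
  have hsn : sn z = v.take n := by simp only [sn]; rw [hz1, pad_snd]
  have hcond : z = pad (fs z) (sn z) ∧ (eval p (fs z))⁻¹ * eval p (sn z) ∈ B :=
    ⟨by rw [hfs, hsn]; exact hz1, by rw [hfs, hsn]; exact hFT u hu v hv huv n⟩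
  by_cases hcond' : z' = pad (fs z') (sn z') ∧ (eval p (fs z'))⁻¹ * eval p (sn z') ∈ B
  swap
  · simp only [f, dif_pos hcond, dif_neg hcond'] at hf
    exact absurd hf (by simp)
  simp only [f, dif_pos hcond, dif_pos hcond', Option.some.injEq, Prod.mk.injEq,
    Subtype.mk.injEq, eq_iff_iff] at hf
  obtain ⟨h1, h2, h3, h4, h5⟩ := hf
  replace h1 := congrArg Subtype.val h1
  replace h2 := congrArg Subtype.val h2
  simp only at h1 h2
  rw [hfs] at h1 h3 h4 h5
  rw [hsn] at h2 h3 h4 h5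
  refine ⟨fs z' ++ u.drop n, ?_, sn z' ++ v.drop n, ?_, ?_, ?_⟩
  · rw [← leftQuotient_congr h1, List.take_append_drop]; exact hu
  · rw [← leftQuotient_congr h2, List.take_append_drop]; exact hv
  · rw [← List.take_append_drop n u, ← List.take_append_drop n v, eval_append, eval_append] at huv
    rw [eval_append, eval_append]
    exact mul_eq_mul_of_inv_mul_eq huv h5
  · rw [pad_append, ← hcond'.1, hz2]
    · intro h
      rw [← h3, List.length_take, List.length_take] at h
      exact List.drop_eq_nil_of_le (by omega)
    · intro h
      rw [← h4, List.length_take, List.length_take] at h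
      exact List.drop_eq_nil_of_le (by omega)

/-- The words of `C` for which right multiplication with `g` leads to an element represented by a
word of `C`. -/
def translatable (C : Language A) (g : G) : Language A :=
  {u | u ∈ C ∧ ∃ v ∈ C, eval p u * g = eval p v}

/-- A subset construction guessing the second word. The guessed y need not have the length of x,
since only group elements matter here. -/
theorem isRegular_translatable {C : Language A} (hC : C.IsRegular) (g : G) {B : Set G}
    (hB : B.Finite) (hFT : ∀ u ∈ C, ∀ v ∈ C, eval p u * g = eval p v →
      ∀ n, (eval p (u.take n))⁻¹ * eval p (v.take n) ∈ B) :
    (translatable p C g).IsRegular := by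
  have := hC.finite_range_leftQuotient.to_subtype
  have := hB.to_subtype
  let f : List A → Set.range C.leftQuotient × Set (Set.range C.leftQuotient × B) := fun x =>
    (⟨C.leftQuotient x, x, rfl⟩,
      {s | ∃ y, C.leftQuotient y = s.1.1 ∧ (eval p x)⁻¹ * eval p y = s.2.1})
  refine isRegular_of_invariant f ?_
  rintro x y hf z ⟨hxz, v, hv, hxv⟩
  simp only [f, Prod.mk.injEq] at hf
  obtain ⟨h1, h2⟩ := hf
  replace h1 := congrArg Subtype.val h1
  simp only at h1
  have hB' := hFT _ hxz v hv hxv x.length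
  rw [List.take_left] at hB'
  have hmem : ((⟨C.leftQuotient (v.take x.length), _, rfl⟩, ⟨_, hB'⟩) :
      Set.range C.leftQuotient × B) ∈ {s : Set.range C.leftQuotient × B |
        ∃ y, C.leftQuotient y = s.1.1 ∧ (eval p x)⁻¹ * eval p y = s.2.1} := ⟨_, rfl, rfl⟩
  rw [h2] at hmem
  obtain ⟨v', h3, h4⟩ := hmem
  refine ⟨(leftQuotient_congr h1).1 hxz, v' ++ v.drop x.length, ?_, ?_⟩
  · rw [leftQuotient_congr h3, List.take_append_drop]; exact hv
  · rw [← List.take_append_drop x.length v, eval_append, eval_append] at hxv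
    rw [eval_append, eval_append]
    exact mul_eq_mul_of_inv_mul_eq hxv h4.symm

theorem isSynchronousAutomatic_of_fellowTravel {C : Language A} (hC : C.IsRegular)
    (hsurj : ∀ g : G, ∃ w ∈ C, eval p w = g)
    (hFT : ∀ g : G, ∃ B : Set G, B.Finite ∧ ∀ u ∈ C, ∀ v ∈ C, eval p u * g = eval p v →
      ∀ n, (eval p (u.take n))⁻¹ * eval p (v.take n) ∈ B) :
    IsSynchronousAutomatic p C where
  regular := hC
  surjective := hsurj
  multiplier x := by
    obtain ⟨B, hB, h⟩ := hFT (eval p x.toList)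
    simp only [eval_append]
    exact isRegular_multiplier p hC _ hB h

end Regularity

end AutGroup

namespace AutGroup

open scoped Pointwise

/-! ### Completing a coarsely dense language by final letters -/

section Extension

variable {A G : Type*} [Group G] {n : ℕ} (p : A → G) (e : Fin n → G) (C : Language A)

/-- The words of `C` as words over a larger alphabet. -/
def liftWord (n : ℕ) (c : List A) : List (A ⊕ Fin n) := c.map Sum.inl

theorem eval_liftWord (c : List A) : eval (Sum.elim p e) (liftWord n c) = eval p c := by
  simp [eval, liftWord, Function.comp_def]

theorem liftWord_injective : Function.Injective (liftWord (A := A) n) :=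
  List.map_injective_iff.2 Sum.inl_injective

theorem liftWord_append (c c' : List A) :
    liftWord n (c ++ c') = liftWord n c ++ liftWord n c' := List.map_append

theorem liftWord_eq_append {c : List A} {x z : List (A ⊕ Fin n)} (h : liftWord n c = x ++ z) :
    ∃ a b, c = a ++ b ∧ liftWord n a = x ∧ liftWord n b = z := by
  obtain ⟨a, b, h1, h2, h3⟩ := List.map_eq_append_iff.1 h
  exact ⟨a, b, h1, h2, h3⟩

/-- The word `c` of `C`, followed by the new letter `i`, is the preferred representative of an
element not represented by a word of `C`. -/
def Preferred (c : List A) (i : Fin n) : Prop :=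
  c ∈ C ∧ (¬ ∃ v ∈ C, eval p c * e i = eval p v) ∧
    ∀ j < i, ¬ ∃ v ∈ C, eval p c * (e i * (e j)⁻¹) = eval p v

/-- The words of `C` together with preferred representatives of the remaining elements. -/
def extension : Language (A ⊕ Fin n) :=
  {w | (∃ c ∈ C, w = liftWord n c) ∨ ∃ c i, Preferred p e C c i ∧ w = liftWord n c ++ [Sum.inr i]}

variable {p e C}

theorem Preferred.notMem {c : List A} {i : Fin n} (h : Preferred p e C c i) :
    ¬ ∃ v ∈ C, eval p c * e i = eval p v := h.2.1

theorem extension_prefixClosed (hC : PrefixClosed C) : PrefixClosed (extension p e C) := by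
  have key : ∀ u c, c ∈ C → u <+: liftWord n c → u ∈ extension p e C := by
    rintro u c hc ⟨z, hz⟩
    obtain ⟨a, b, rfl, rfl, -⟩ := liftWord_eq_append hz.symm
    exact Or.inl ⟨a, hC a _ (List.prefix_append _ _) hc, rfl⟩
  rintro u w huw (⟨c, hc, rfl⟩ | ⟨c, i, hci, rfl⟩)
  · exact key u c hc huw
  · rcases List.prefix_concat_iff.1 huw with rfl | h
    · exact Or.inr ⟨c, i, hci, rfl⟩
    · exact key u c hci.1 h

theorem eval_lift_concat (c : List A) (i : Fin n) :
    eval (Sum.elim p e) (liftWord n c ++ [Sum.inr i]) = eval p c * e i := by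
  rw [eval_append, eval_liftWord]; simp [eval]

/-- For j < i the element c e_i e_j⁻¹ would be represented by c' ∈ C, against the minimality of i.
-/
theorem Preferred.le {c c' : List A} {i j : Fin n} (h : Preferred p e C c i)
    (h' : Preferred p e C c' j) (heq : eval p c * e i = eval p c' * e j) : i ≤ j := by
  by_contra hlt
  refine h.2.2 j (not_le.1 hlt) ⟨c', h'.1, ?_⟩
  rw [← mul_assoc, heq, mul_inv_cancel_right]

theorem extension_uniqueness (hC : Uniqueness p C) :
    Uniqueness (Sum.elim p e) (extension p e C) := by
  rintro u (⟨c, hc, rfl⟩ | ⟨c, i, hci, rfl⟩) v (⟨c', hc', rfl⟩ | ⟨c', j, hcj, rfl⟩) huv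
  · rw [eval_liftWord, eval_liftWord] at huv
    rw [hC c hc c' hc' huv]
  · rw [eval_liftWord, eval_lift_concat] at huv
    exact absurd ⟨c, hc, huv.symm⟩ hcj.notMem
  · rw [eval_liftWord, eval_lift_concat] at huv
    exact absurd ⟨c', hc', huv⟩ hci.notMem
  · rw [eval_lift_concat, eval_lift_concat] at huv
    obtain rfl : i = j := le_antisymm (hci.le hcj huv) (hcj.le hci huv.symm)
    rw [hC c hci.1 c' hcj.1 (mul_right_cancel huv)]

theorem extension_surjective (he : ∀ g : G, ∃ c ∈ C, ∃ i, eval p c * e i = g) (g : G) :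
    ∃ w ∈ extension p e C, eval (Sum.elim p e) w = g := by
  by_cases hg : ∃ c ∈ C, eval p c = g
  · obtain ⟨c, hc, rfl⟩ := hg
    exact ⟨_, Or.inl ⟨c, hc, rfl⟩, eval_liftWord p e c⟩
  · obtain ⟨i, ⟨c, hc, hci⟩, hmin⟩ := WellFounded.has_min
      (wellFounded_lt (α := Fin n)) {i | ∃ c ∈ C, eval p c * e i = g}
      (by obtain ⟨c, hc, i, h⟩ := he g; exact ⟨i, c, hc, h⟩)
    refine ⟨_, Or.inr ⟨c, i, ⟨hc, ?_, ?_⟩, rfl⟩, (eval_lift_concat c i).trans hci⟩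
    · rintro ⟨v, hv, h⟩
      exact hg ⟨v, hv, by rw [← h, hci]⟩
    · rintro j hj ⟨v, hv, h⟩
      refine hmin j ⟨v, hv, ?_⟩ hj
      rw [← h, ← hci]; group

theorem extension_regular (hC : ∀ g, (translatable p C g).IsRegular) :
    (extension p e C).IsRegular := by
  classical
  -- The index `none` stands for membership in C, the others for the elements e_i and e_i e_j⁻¹ in
  -- the definition of `Preferred`.
  let g : Option (Fin n × Option (Fin n)) → G := fun k => k.elim 1 fun ij =>
    ij.2.elim (e ij.1) fun j => e ij.1 * (e j)⁻¹
  have hfin := fun k => (hC (g k)).finite_range_leftQuotient.to_subtype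
  let F : List A → (∀ k, Set.range (translatable p C (g k)).leftQuotient) := fun c k =>
    ⟨_, c, rfl⟩
  have hF : ∀ {x y : List A}, F x = F y → ∀ z k, x ++ z ∈ translatable p C (g k) →
      y ++ z ∈ translatable p C (g k) := by
    intro x y h z k hx
    exact (leftQuotient_congr (congrArg Subtype.val (congrFun h k))).1 hx
  have hmem : ∀ c, c ∈ C ↔ c ∈ translatable p C (g none) := fun c =>
    ⟨fun h => ⟨h, c, h, mul_one _⟩, fun h => h.1⟩
  have hpref : ∀ {x y : List A}, F x = F y → ∀ z i, Preferred p e C (x ++ z) i →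
      Preferred p e C (y ++ z) i := by
    rintro x y h z i ⟨h1, h2, h3⟩
    have h4 : y ++ z ∈ C := (hmem _).2 (hF h z none ((hmem _).1 h1))
    refine ⟨h4, fun h5 => h2 ?_, fun j hj h5 => h3 j hj ?_⟩
    · exact (hF h.symm z (some (i, none)) ⟨h4, h5⟩).2
    · exact (hF h.symm z (some (i, some j)) ⟨h4, h5⟩).2
  -- A word containing a new letter has at most the empty continuation, so membership is all that
  -- must be remembered for it.
  let f : List (A ⊕ Fin n) → Option (∀ k, Set.range (translatable p C (g k)).leftQuotient) × Prop :=
    fun w => (if h : ∃ c, liftWord n c = w then some (F h.choose) else none, w ∈ extension p e C)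
  have hf1 : ∀ c, (f (liftWord n c)).1 = some (F c) := by
    intro c
    have h : ∃ c', liftWord n c' = liftWord n c := ⟨c, rfl⟩
    have := liftWord_injective h.choose_spec
    simp only [f, dif_pos h, this]
  have hf2 : ∀ w, (¬ ∃ c, liftWord n c = w) → (f w).1 = none := fun w h => by
    simp only [f, dif_neg h]
  refine isRegular_of_invariant f fun x y hxy z hx => ?_
  have hxy1 := congrArg Prod.fst hxy
  by_cases h : ∃ c, liftWord n c = x
  · obtain ⟨c, rfl⟩ := h
    rw [hf1] at hxy1
    obtain ⟨c', rfl⟩ : ∃ c', liftWord n c' = y := by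
      by_contra hy
      rw [hf2 y hy] at hxy1
      exact absurd hxy1 (by simp)
    rw [hf1, Option.some_inj] at hxy1
    rcases hx with ⟨c₁, hc₁, heq⟩ | ⟨c₁, i, hc₁, heq⟩
    · obtain ⟨a, b, rfl, ha, rfl⟩ := liftWord_eq_append heq.symm
      obtain rfl := liftWord_injective ha
      refine Or.inl ⟨c' ++ b, ?_, (liftWord_append _ _).symm⟩
      exact (hmem _).2 (hF hxy1 b none ((hmem _).1 hc₁))
    · rcases List.eq_nil_or_concat z with rfl | ⟨z', l, rfl⟩
      · exfalso
        rw [List.append_nil] at heq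
        obtain ⟨a, b, -, -, hb⟩ := liftWord_eq_append heq
        cases b <;> simp [liftWord] at hb
      · rw [List.concat_eq_append, ← List.append_assoc] at heq
        obtain ⟨h1, h2⟩ := List.append_inj' heq rfl
        obtain ⟨a, b, rfl, ha, rfl⟩ := liftWord_eq_append h1.symm
        obtain rfl := liftWord_injective ha
        refine Or.inr ⟨c' ++ b, i, hpref hxy1 b i hc₁, ?_⟩
        rw [List.concat_eq_append, liftWord_append, h2, List.append_assoc]
  · have hz : z = [] := by
      rcases hx with ⟨c₁, hc₁, heq⟩ | ⟨c₁, i, hc₁, heq⟩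
      · obtain ⟨a, b, -, ha, -⟩ := liftWord_eq_append heq.symm
        exact absurd ⟨a, ha⟩ h
      · rcases List.eq_nil_or_concat z with rfl | ⟨z', l, rfl⟩
        · rfl
        · rw [List.concat_eq_append, ← List.append_assoc] at heq
          obtain ⟨a, b, -, ha, -⟩ := liftWord_eq_append (List.append_inj' heq rfl).1.symm
          exact absurd ⟨a, ha⟩ h
    subst hz
    rw [List.append_nil] at hx ⊢
    exact (congrArg Prod.snd hxy).mp hx

theorem exists_eval_take {w : List (A ⊕ Fin n)} (hw : w ∈ extension p e C) :
    ∃ c ∈ C, ∀ m, ∃ x ∈ insert 1 (Set.range e),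
      eval (Sum.elim p e) (w.take m) = eval p (c.take m) * x := by
  rcases hw with ⟨c, hc, rfl⟩ | ⟨c, i, hci, rfl⟩
  · refine ⟨c, hc, fun m => ⟨1, Set.mem_insert _ _, ?_⟩⟩
    rw [mul_one, ← eval_liftWord p e, liftWord, liftWord, List.map_take]
  · refine ⟨c, hci.1, fun m => ?_⟩
    rcases le_or_gt m c.length with hm | hm
    · refine ⟨1, Set.mem_insert _ _, ?_⟩
      rw [mul_one, ← eval_liftWord p e, liftWord, liftWord, List.map_take,
        List.take_append_of_le_length (by simpa using hm)]
    · refine ⟨e i, Set.mem_insert_of_mem _ ⟨i, rfl⟩, ?_⟩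
      rw [List.take_of_length_le (by simp [liftWord]; omega), List.take_of_length_le hm.le,
        eval_lift_concat]

theorem exists_eval {w : List (A ⊕ Fin n)} (hw : w ∈ extension p e C) :
    ∃ c ∈ C, (∃ x ∈ insert 1 (Set.range e), eval (Sum.elim p e) w = eval p c * x) ∧
      ∀ m, ∃ x ∈ insert 1 (Set.range e),
        eval (Sum.elim p e) (w.take m) = eval p (c.take m) * x := by
  obtain ⟨c, hc, h⟩ := exists_eval_take hw
  refine ⟨c, hc, ?_, h⟩
  have := h (max w.length c.length)
  rwa [List.take_of_length_le (le_max_left _ _), List.take_of_length_le (le_max_right _ _)] at this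

/-- Prefixes differ from prefixes of words of C by factors from the finite set E, so g is reduced to
the finitely many elements x g y⁻¹. -/
theorem extension_fellowTravel
    (hFT : ∀ g : G, ∃ B : Set G, B.Finite ∧ ∀ u ∈ C, ∀ v ∈ C, eval p u * g = eval p v →
      ∀ m, (eval p (u.take m))⁻¹ * eval p (v.take m) ∈ B) (g : G) :
    ∃ B : Set G, B.Finite ∧ ∀ u ∈ extension p e C, ∀ v ∈ extension p e C,
      eval (Sum.elim p e) u * g = eval (Sum.elim p e) v →
      ∀ m, (eval (Sum.elim p e) (u.take m))⁻¹ * eval (Sum.elim p e) (v.take m) ∈ B := by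
  choose B hB hBFT using hFT
  set E : Set G := insert 1 (Set.range e)
  have hE : E.Finite := (Set.finite_range e).insert 1
  refine ⟨⋃ x ∈ E, ⋃ y ∈ E, E⁻¹ * B (x * g * y⁻¹) * E, ?_, ?_⟩
  · exact hE.biUnion fun x _ => hE.biUnion fun y _ => (hE.inv.mul (hB _)).mul hE
  · intro u hu v hv huv m
    obtain ⟨c, hc, ⟨x, hx, hux⟩, hc'⟩ := exists_eval hu
    obtain ⟨d, hd, ⟨y, hy, hvy⟩, hd'⟩ := exists_eval hv
    obtain ⟨x', hx', h1⟩ := hc' m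
    obtain ⟨y', hy', h2⟩ := hd' m
    rw [hux, hvy] at huv
    have hb := hBFT (x * g * y⁻¹) c hc d hd (by
      rw [← mul_assoc, ← mul_assoc, huv, mul_inv_cancel_right]) m
    simp only [Set.mem_iUnion]
    refine ⟨x, hx, y, hy, ?_⟩
    rw [h1, h2]
    have : (eval p (c.take m) * x')⁻¹ * (eval p (d.take m) * y') =
        x'⁻¹ * ((eval p (c.take m))⁻¹ * eval p (d.take m)) * y' := by group
    rw [this]
    exact Set.mul_mem_mul (Set.mul_mem_mul (Set.inv_mem_inv.2 hx') hb) hy'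

end Extension

/-! ### Structures from dense languages and from edges -/

section Construction

variable {G : Type*} [Group G]

/-- A prefix-closed regular language with uniqueness which fellow travels and is coarsely dense can
be completed to a synchronous automatic structure. -/
theorem hasPrefixClosedSynchronousStructure_of_dense {A : Type} [Finite A] {p : A → G}
    {C : Language A} (hreg : C.IsRegular) (hpre : PrefixClosed C) (huniq : Uniqueness p C)
    (hFT : ∀ g : G, ∃ B : Set G, B.Finite ∧ ∀ u ∈ C, ∀ v ∈ C, eval p u * g = eval p v →
      ∀ m, (eval p (u.take m))⁻¹ * eval p (v.take m) ∈ B)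
    {E : Set G} (hE : E.Finite) (hdense : ∀ g : G, ∃ c ∈ C, ∃ x ∈ E, eval p c * x = g) :
    HasPrefixClosedSynchronousStructure G := by
  have := hE.to_subtype
  obtain ⟨n, ⟨f⟩⟩ := Finite.exists_equiv_fin E
  let e : Fin n → G := fun i => f.symm i
  have he : ∀ g : G, ∃ c ∈ C, ∃ i, eval p c * e i = g := by
    intro g
    obtain ⟨c, hc, x, hx, h⟩ := hdense g
    exact ⟨c, hc, f ⟨x, hx⟩, by simpa [e] using h⟩
  refine ⟨A ⊕ Fin n, inferInstance, Sum.elim p e, extension p e C, ?_,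
    extension_prefixClosed hpre, extension_uniqueness huniq⟩
  refine isSynchronousAutomatic_of_fellowTravel _ (extension_regular fun g => ?_)
    (extension_surjective he) (extension_fellowTravel hFT)
  obtain ⟨B, hB, h⟩ := hFT g
  exact isRegular_translatable p hreg g hB h

/-- If the edges of the Cayley diagram fellow travel with respect to a transversal, then so do any
two words of the transversal. -/
theorem fellowTravel_of_edges {A : Type*} {p : A → G} {S : Set (List A)}
    (hsurj : ∀ g, ∃ t ∈ S, eval p t = g)
    (hinj : ∀ t ∈ S, ∀ t' ∈ S, eval p t = eval p t' → t = t')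
    (hedge : ∀ a : A, ∃ B : Set G, B.Finite ∧ ∀ t ∈ S, ∀ t' ∈ S, eval p t * p a = eval p t' →
      ∀ m, (eval p (t.take m))⁻¹ * eval p (t'.take m) ∈ B) (g : G) :
    ∃ B : Set G, B.Finite ∧ ∀ t ∈ S, ∀ t' ∈ S, eval p t * g = eval p t' →
      ∀ m, (eval p (t.take m))⁻¹ * eval p (t'.take m) ∈ B := by
  obtain ⟨x, -, rfl⟩ := hsurj g
  induction x with
  | nil =>
    refine ⟨{1}, Set.finite_singleton 1, fun t ht t' ht' h m => ?_⟩
    obtain rfl := hinj t ht t' ht' (by simpa [eval] using h)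
    simp
  | cons a x ih =>
    obtain ⟨B, hB, h⟩ := ih
    obtain ⟨B', hB', h'⟩ := hedge a
    refine ⟨B' * B, hB'.mul hB, fun t ht t' ht' htt' m => ?_⟩
    obtain ⟨s, hs, hts⟩ := hsurj (eval p t * p a)
    have h1 := h' t ht s hs hts.symm m
    have h2 := h s hs t' ht' (by
      rw [hts, ← htt']; simp [eval, mul_assoc]) m
    convert Set.mul_mem_mul h1 h2 using 1
    group

end Construction

end AutGroup

namespace AutGroup

open FreeGroup

/-! ### Choosing between a generator and its inverse -/

section Selection

variable {α : Type*} {L : Language (α × Bool)} {d : List (α × Bool) → MarkedWord α}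

theorem word_signed (hs : IsSignificant L d) {w : List (α × Bool)} (hw : w ∈ L) (ε : Bool) :
    ((d w).signed ε).word = if ε then w else invRev w := by
  cases ε <;> simp [MarkedWord.signed, MarkedWord.word_inv, hs.word_eq w hw]

theorem inv_signed (m : MarkedWord α) (ε : Bool) : (m.signed ε).inv = m.signed (!ε) := by
  cases ε <;> simp [MarkedWord.signed, MarkedWord.inv_inv]

/-- The marked words of `L` and their inverses form a marking after one of `w` and `w⁻¹` is
discarded if both are in `L`. -/
theorem exists_isMarking [Countable α] (hs : IsSignificant L d) :
    ∃ M : Set (MarkedWord α), IsMarking M ∧ (∀ m ∈ M, ∃ w ∈ L, ∃ ε, m = (d w).signed ε) ∧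
      (∀ w ∈ L, ∃ m ∈ M, m.word = w) := by
  obtain ⟨enc, henc⟩ := exists_injective_nat (List (α × Bool))
  have hinv : ∀ w ∈ L, enc w ≠ enc (invRev w) := fun w hw h =>
    ne_invRev (hs.reduced w hw) (hs.ne_nil w hw) (henc h)
  -- If w and w⁻¹ are both in L, their distinguished letters need not correspond, since significance
  -- says nothing about trivial products. The numbering keeps one of them.
  set L' : Set (List (α × Bool)) := {w | w ∈ L ∧ (invRev w ∈ L → enc w < enc (invRev w))} with hL'
  set M : Set (MarkedWord α) := {m | ∃ w ∈ L', ∃ ε, m = (d w).signed ε} with hM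
  have hinvM : ∀ m ∈ M, m.inv ∈ M := by
    rintro _ ⟨w, hw, ε, rfl⟩
    exact ⟨w, hw, !ε, inv_signed _ _⟩
  have hred : ∀ m ∈ M, IsReduced m.word := by
    rintro _ ⟨w, hw, ε, rfl⟩
    rw [word_signed hs hw.1]
    split
    · exact hs.reduced w hw.1
    · exact isReduced_invRev (hs.reduced w hw.1)
  refine ⟨M, ⟨hred, hinvM, ?_⟩, ?_, ?_⟩
  · intro m₁ h₁ m₂ h₂ hne
    have hr₁ := hred _ (hinvM _ h₁)
    have hr₂ := hred _ h₂
    obtain ⟨w₁, hw₁, ε₁, rfl⟩ := h₁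
    obtain ⟨w₂, hw₂, ε₂, rfl⟩ := h₂
    refine hs.significant w₁ hw₁.1 w₂ hw₂.1 ε₁ ε₂ fun hred => hne ?_
    have heq : ((d w₁).signed ε₁).inv.word = ((d w₂).signed ε₂).word := by
      apply eq_of_mk_eq hr₁ hr₂
      have : FreeGroup.mk (((d w₁).signed ε₁).word ++ ((d w₂).signed ε₂).word) = 1 :=
        Red.exact.2 ⟨[], hred, .refl⟩
      rw [← mul_mk] at this
      rw [MarkedWord.word_inv, ← inv_mk]
      exact inv_eq_of_mul_eq_one_right this
    rw [inv_signed, word_signed hs hw₁.1, word_signed hs hw₂.1] at heq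
    rw [inv_signed]
    have hcon : ∀ w ∈ L', ¬ invRev w ∈ L' := by
      intro w hw hw'
      have h1 := hw.2 hw'.1
      have h2 := hw'.2 (by simpa using hw.1)
      rw [invRev_invRev] at h2
      omega
    cases ε₁ <;> cases ε₂ <;> simp only [Bool.not_true, Bool.not_false, if_true,
      Bool.false_eq_true, if_false] at heq ⊢
    · exact absurd (heq ▸ hw₁) (hcon _ hw₂)
    · rw [heq]
    · rw [invRev_injective heq]
    · exact absurd (heq ▸ hw₂) (hcon _ hw₁)
  · rintro _ ⟨w, hw, ε, rfl⟩
    exact ⟨w, hw.1, ε, rfl⟩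
  · intro w hw
    by_cases h : w ∈ L'
    · exact ⟨_, ⟨w, h, true, rfl⟩, by rw [word_signed hs hw]; rfl⟩
    · simp only [hL', Set.mem_ofPred_eq, hw, true_and] at h
      push Not at h
      have h' : invRev w ∈ L' := ⟨h.1, fun _ => by
        rw [invRev_invRev]; exact lt_of_le_of_ne h.2 (hinv w hw).symm⟩
      exact ⟨_, ⟨invRev w, h', false, rfl⟩, by rw [word_signed hs h.1]; simp⟩

end Selection

/-! ### A regular part of the tree -/

section Middle

variable {A V : Type*} (T : Transducer A V)

/-- The first labels of those paths from the initial vertex which can be continued to successful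
paths by labels of length at least `k`. -/
def initialLanguage (k : ℕ) : Language A :=
  {u | ∃ s v, T.Path T.initial s u v ∧
    ∃ q ∈ T.terminal, ∃ r t, T.Path s q r t ∧ k ≤ r.length ∧ k ≤ t.length}

/-- The possible continuations of x depend only on the set of vertices reached with first label x.
-/
theorem initialLanguage_regular [Finite V] (k : ℕ) : (initialLanguage T k).IsRegular := by
  refine isRegular_of_invariant (fun x => {s | ∃ v, T.Path T.initial s x v}) ?_
  rintro x y hxy z ⟨s, v, hp, hs⟩
  obtain ⟨q, v₁, v₂, rfl, h1, h2⟩ := hp.split rfl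
  have h3 : q ∈ {s | ∃ v, T.Path T.initial s x v} := ⟨v₁, h1⟩
  rw [hxy] at h3
  obtain ⟨v', h4⟩ := h3
  exact ⟨s, v' ++ v₂, h4.append h2, hs⟩

theorem initialLanguage_prefixClosed (k : ℕ) : PrefixClosed (initialLanguage T k) := by
  rintro u _ ⟨u', rfl⟩ ⟨s, v, hp, q, hq, r, t, h1, h2, h3⟩
  obtain ⟨s', v₁, v₂, rfl, h4, h5⟩ := hp.split rfl
  exact ⟨s', v₁, h4, q, hq, _, _, h5.append h1, by simp; omega, by simp; omega⟩

variable {α : Type*} {T : Transducer (α × Bool) V} {L : Language (α × Bool)}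
  {M : Set (MarkedWord α)}

/-- The k letters still to come on both sides outweigh the imbalance K₁ and the deviation K₂ from
the center, so u stops before the distinguished letter. -/
theorem initialLanguage_subset {K₁ K₂ k : ℕ} (hT : IsFolding T L)
    (hK₁ : ∀ q, T.Coaccessible q → ∀ u v, T.Path T.initial q u v →
      u.length ≤ v.length + K₁ ∧ v.length ≤ u.length + K₁)
    (hK₂ : ∀ m ∈ M, m.word.length ≤ 2 * m.pre.length + K₂)
    (hL : ∀ w ∈ L, ∃ m ∈ M, m.word = w) (hk : K₁ + K₂ ≤ k) {u : List (α × Bool)}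
    (hu : u ∈ initialLanguage T k) : u ∈ markTree M := by
  obtain ⟨s, v, hp, q, hq, r, t, h1, h2, h3⟩ := hu
  have hb := hK₁ s ⟨q, hq, r, t, h1⟩ u v hp
  obtain ⟨m, hm, hmw⟩ := hL _ (hT.mem hp hq h1)
  have hc := hK₂ m hm
  refine ⟨m, hm, List.prefix_of_prefix_length_le (l₃ := m.word)
    ⟨r ++ invRev (v ++ t), by rw [hmw]; simp⟩ (List.prefix_append _ _) ?_⟩
  rw [hmw] at hc
  simp only [List.length_append, invRev_length] at hc
  omega

/-- After removal of k + 3K₁ + K₂ letters from t, both labels have k letters to go: 2K₁ pays for the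
passage from first to second labels, K₁ + K₂ for the deviation from the center. Shorter t are
approximated by the empty word. -/
theorem exists_mem_initialLanguage {K₁ K₂ k : ℕ} (hT : IsFolding T L)
    (hK₁ : ∀ q, T.Coaccessible q → ∀ u v, T.Path T.initial q u v →
      u.length ≤ v.length + K₁ ∧ v.length ≤ u.length + K₁)
    {w t : List (α × Bool)} (hw : w ∈ L) (ht : t <+: w) (htl : 2 * t.length ≤ w.length + K₂) :
    ∃ c, (c ∈ initialLanguage T k ∨ c = []) ∧ c <+: t ∧
      t.length ≤ c.length + (k + 3 * K₁ + K₂) := by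
  by_cases hD : t.length ≤ k + 3 * K₁ + K₂
  · exact ⟨[], Or.inr rfl, List.nil_prefix, by simpa using hD⟩
  obtain ⟨⟨u, v⟩, ⟨f, hf, hpath⟩, hwx⟩ := (hT w).1 hw
  simp only at hpath hwx
  have hc : T.Coaccessible f := ⟨f, hf, [], [], .nil f⟩
  have hb := hK₁ f hc u v hpath
  have hlen := congrArg List.length hwx
  simp only [List.length_append, invRev_length] at hlen
  set c := t.take (t.length - (k + 3 * K₁ + K₂)) with hcdef
  have hcl : c.length = t.length - (k + 3 * K₁ + K₂) := by simp [hcdef]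
  have hct : c <+: t := List.take_prefix _ _
  obtain ⟨r, hr⟩ : c <+: u := List.prefix_of_prefix_length_le (hct.trans ht)
    ⟨invRev v, hwx.symm⟩ (by omega)
  obtain ⟨s, v₁, v₂, hv, h1, h2⟩ := hpath.split hr.symm
  have hb' := hK₁ s (hc.of_path h2) _ _ h1
  have hrl := congrArg List.length hr
  have hvl := congrArg List.length hv
  simp only [List.length_append] at hrl hvl
  exact ⟨c, Or.inl ⟨s, v₁, h1, f, hf, r, v₂, h2, by omega, by omega⟩, hct, by omega⟩

end Middle

/-! ### The automatic structure of the quotient -/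

section Quotient

variable {α G : Type*} [Group G] (φ : FreeGroup α →* G)

theorem eval_eq_map (w : List (α × Bool)) :
    eval (fun a => φ (FreeGroup.mk [a])) w = φ (FreeGroup.mk w) := by
  induction w with
  | nil => exact (_root_.map_one φ).symm
  | cons a w ih =>
    have : FreeGroup.mk (a :: w) = FreeGroup.mk [a] * FreeGroup.mk w := by rw [mul_mk]; rfl
    rw [this, _root_.map_mul, ← ih]
    simp [eval]

theorem map_eq_iff {u v : List (α × Bool)} :
    φ (FreeGroup.mk u) = φ (FreeGroup.mk v) ↔ FreeGroup.mk (u ++ invRev v) ∈ φ.ker := by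
  rw [MonoidHom.mem_ker, ← mul_mk, _root_.map_mul, ← inv_mk, _root_.map_inv, mul_inv_eq_one]

/-- The elements of `G` represented by words of length at most `k`. -/
def wordBall (k : ℕ) : Set G := (fun x => φ (FreeGroup.mk x)) '' {x | x.length ≤ k}

theorem wordBall_finite [Finite α] (k : ℕ) : (wordBall φ k).Finite :=
  (List.finite_length_le _ k).image _

theorem NearMod.mem_wordBall {k : ℕ} {g h : List (α × Bool)} (hgh : NearMod φ.ker k g h) :
    (φ (FreeGroup.mk g))⁻¹ * φ (FreeGroup.mk h) ∈ wordBall φ k := by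
  obtain ⟨x, hx, heq⟩ := hgh
  refine ⟨x, hx, ?_⟩
  rw [QuotientGroup.eq, MonoidHom.mem_ker, _root_.map_mul, _root_.map_inv, inv_mul_eq_one, ← mul_mk,
    _root_.map_mul] at heq
  simp only
  rw [← heq, inv_mul_cancel_left]

variable {φ}

/-- The set of reduced words is a prefix-closed synchronous automatic structure with uniqueness on
a free group. -/
theorem hasPrefixClosedSynchronousStructure_of_injective {α : Type} [Finite α]
    {φ : FreeGroup α →* G} (hsurj : Function.Surjective φ) (hinj : Function.Injective φ) :
    HasPrefixClosedSynchronousStructure G := by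
  classical
  set p : α × Bool → G := fun a => φ (FreeGroup.mk [a])
  set C : Language (α × Bool) := {w | IsReduced w}
  have hp : ∀ w, eval p w = φ (FreeGroup.mk w) := eval_eq_map φ
  have huniq : Uniqueness p C := by
    intro u hu v hv h
    rw [hp, hp] at h
    exact eq_of_mk_eq hu hv (hinj h)
  have hC : ∀ g : G, ∃ w ∈ C, eval p w = g := by
    intro g
    obtain ⟨g, rfl⟩ := hsurj g
    exact ⟨g.toWord, isReduced_toWord, by rw [hp, mk_toWord]⟩
  refine hasPrefixClosedSynchronousStructure_of_dense (p := p) (C := C) (E := {1}) ?_ ?_ huniq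
    ?_ (Set.finite_singleton 1) ?_
  · refine isRegular_of_invariant (fun w => (IsReduced w, w.getLast?)) ?_
    intro x y hxy z hz
    simp only [Prod.mk.injEq, eq_iff_iff] at hxy
    have hz' := isReduced_append_iff.1 hz
    refine isReduced_append_iff.2 ⟨hxy.1.1 hz'.1, hz'.2.1, ?_⟩
    rw [← hxy.2]
    exact hz'.2.2
  · intro u w huw hw
    exact isReduced_of_prefix hw huw
  · refine fellowTravel_of_edges (S := {w | w ∈ C}) hC huniq fun a =>
      ⟨wordBall φ 1, wordBall_finite φ 1, ?_⟩
    intro t ht t' ht' h m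
    rw [hp, hp]
    apply NearMod.mem_wordBall
    have hmk : FreeGroup.mk (t ++ [a]) = FreeGroup.mk t' := by
      apply hinj
      rw [← hp, ← hp, eval_append, ← h]; simp [eval]
    by_cases hr : IsReduced (t ++ [a])
    · obtain rfl := eq_of_mk_eq hr ht' hmk
      refine NearMod.of_prefix (w := t ++ [a]) ((List.take_prefix _ _).trans
        (List.prefix_append _ _)) (List.take_prefix _ _) ?_ ?_ <;>
      · simp only [List.length_take, List.length_append, List.length_singleton]
        omega
    · obtain ⟨t₀, c, B, h1, h2, h3⟩ := exists_cancel ht (IsReduced.singleton (a := a))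
      rw [h1, h2, mk_append_cancel] at hmk
      obtain rfl := eq_of_mk_eq h3 ht' hmk
      have hlen := congrArg List.length h2
      simp only [List.length_append, invRev_length, List.length_singleton] at hlen
      have hB : B = [] := by
        by_contra hB
        apply hr
        have h4 : c = [] := by
          rw [← List.length_eq_zero_iff]
          have := List.length_pos_iff.2 hB
          omega
        subst h4
        rw [h1, h2]
        simpa using h3
      subst hB
      rw [h1]
      refine NearMod.of_prefix (w := t₀ ++ c) (List.take_prefix _ _) ((List.take_prefix _ _).trans
        (by simp)) ?_ ?_ <;>
      · simp only [List.length_take, List.length_append, List.length_nil] at hlen ⊢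
        omega
  · intro g
    obtain ⟨w, hw, h⟩ := hC g
    exact ⟨w, hw, 1, rfl, by rw [mul_one, h]⟩

theorem SyncFellowTravel.symm {N : Subgroup (FreeGroup α)} [N.Normal] {k : ℕ}
    {u v : List (α × Bool)} (h : SyncFellowTravel N k u v) : SyncFellowTravel N k v u :=
  fun t => NearMod.symm (h t)

theorem hasPrefixClosedSynchronousStructure_of_isFolding {α V : Type} [Finite α] [Finite V]
    {φ : FreeGroup α →* G} (hsurj : Function.Surjective φ) {L : Language (α × Bool)}
    {d : List (α × Bool) → MarkedWord α} {T : Transducer (α × Bool) V} (hT : IsFolding T L)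
    (hgen : Generates L φ.ker) (hs : IsSignificant L d) (ho : IsOCentral L d) :
    HasPrefixClosedSynchronousStructure G := by
  -- For a trivial kernel L and the tree are empty, so the free group is treated directly.
  by_cases hbot : φ.ker = ⊥
  · exact hasPrefixClosedSynchronousStructure_of_injective hsurj
      ((MonoidHom.ker_eq_bot_iff φ).1 hbot)
  have hLN : ∀ w ∈ L, FreeGroup.mk w ∈ φ.ker := by
    intro w hw
    rw [← hgen]
    exact Subgroup.subset_closure ⟨w, hw, rfl⟩
  obtain ⟨M, hM, hMd, hLM⟩ := exists_isMarking hs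
  have hLM' : ∀ w ∈ invLanguage L, ∃ m ∈ M, m.word = w := by
    intro w hw
    obtain ⟨m, hm, hmw⟩ := hLM _ hw
    exact ⟨m.inv, hM.inv_mem m hm, by rw [MarkedWord.word_inv, hmw, invRev_invRev]⟩
  have hMN : markSubgroup M = φ.ker := by
    rw [← hgen]
    apply le_antisymm
    · rw [markSubgroup, Subgroup.closure_le]
      rintro _ ⟨m, hm, rfl⟩
      obtain ⟨w, hw, ε, rfl⟩ := hMd m hm
      rw [word_signed hs hw]
      have hmem : FreeGroup.mk w ∈ Subgroup.closure {g | ∃ w ∈ L, FreeGroup.mk w = g} :=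
        Subgroup.subset_closure ⟨w, hw, rfl⟩
      split
      · exact hmem
      · rw [← inv_mk]; exact Subgroup.inv_mem _ hmem
    · rw [Subgroup.closure_le]
      rintro _ ⟨w, hw, rfl⟩
      obtain ⟨m, hm, rfl⟩ := hLM w hw
      exact mk_word_mem hm
  obtain ⟨K₁, hK₁⟩ := exists_balance hT hs ho
  obtain ⟨K₁', hK₁'⟩ := exists_balance hT.inverse hs.inverse ho.inverse
  obtain ⟨K₂, hK₂⟩ := exists_length_le_pre_suf hT hs ho
  obtain ⟨k₀, hk₀⟩ := exists_syncFellowTravel hT hs ho hLN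
  have hMK : ∀ m ∈ M, m.word.length ≤ 2 * m.pre.length + K₂ ∧
      m.word.length ≤ 2 * m.suf.length + K₂ := by
    intro m hm
    obtain ⟨w, hw, ε, rfl⟩ := hMd m hm
    have := hK₂ w hw
    rw [word_signed hs hw]
    cases ε <;> simp [MarkedWord.signed, MarkedWord.inv, this]
  have hMFT : ∀ m ∈ M, SyncFellowTravel φ.ker k₀ m.pre (invRev m.suf) := by
    intro m hm
    obtain ⟨w, hw, ε, rfl⟩ := hMd m hm
    cases ε
    · simpa [MarkedWord.signed, MarkedWord.inv] using (hk₀ w hw).symm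
    · exact hk₀ w hw
  have : (markSubgroup M).Normal := hMN ▸ MonoidHom.normal_ker φ
  set p : α × Bool → G := fun a => φ (FreeGroup.mk [a])
  have hp : ∀ w, eval p w = φ (FreeGroup.mk w) := eval_eq_map φ
  have hTsurj : ∀ g, ∃ t ∈ markTree M, eval p t = g := by
    classical
    intro g
    obtain ⟨g, rfl⟩ := hsurj g
    obtain ⟨t, ht, htN⟩ := hM.markTree_surjective (hMN ▸ hbot) g.toWord
    refine ⟨t, ht, ?_⟩
    rw [hMN, ← map_eq_iff] at htN
    rw [hp, ← htN, mk_toWord]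
  have hTinj : ∀ t ∈ markTree M, ∀ t' ∈ markTree M, eval p t = eval p t' → t = t' := by
    intro t ht t' ht' h
    rw [hp, hp, map_eq_iff, ← hMN] at h
    exact hM.markTree_injective ht ht' h
  have hedge : ∀ a, ∃ B : Set G, B.Finite ∧ ∀ t ∈ markTree M, ∀ t' ∈ markTree M,
      eval p t * p a = eval p t' → ∀ m, (eval p (t.take m))⁻¹ * eval p (t'.take m) ∈ B := by
    intro a
    refine ⟨wordBall φ (k₀ + 1), wordBall_finite φ _, fun t ht t' ht' h m => ?_⟩
    have hN : FreeGroup.mk (t ++ [a] ++ invRev t') ∈ markSubgroup M := by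
      rw [hMN, ← map_eq_iff, ← hp t', ← h, ← mul_mk, _root_.map_mul, ← hp t]
    rw [hp, hp]
    apply NearMod.mem_wordBall
    rcases hM.markTree_edge ht ht' hN with rfl | rfl | ⟨x, hx, rfl, -, h3⟩
    · refine NearMod.of_prefix (w := t ++ [a]) ((List.take_prefix _ _).trans
        (List.prefix_append _ _)) (List.take_prefix _ _) ?_ ?_ <;>
      · simp only [List.length_take, List.length_append, List.length_singleton]
        omega
    · refine NearMod.of_prefix (w := t' ++ [(a.1, !a.2)]) (List.take_prefix _ _)
        ((List.take_prefix _ _).trans (List.prefix_append _ _)) ?_ ?_ <;>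
      · simp only [List.length_take, List.length_append, List.length_singleton]
        omega
    · have := hMFT x hx m
      rw [h3, invRev_invRev] at this
      exact NearMod.mono this (Nat.le_succ _)
  have hFT := fellowTravel_of_edges hTsurj hTinj hedge
  -- This is large enough for both `T` and `T.swap`. Both are needed, because the tree comes from
  -- generators and their inverses.
  set k := K₁ + K₁' + K₂ with hk
  set C : Language (α × Bool) := initialLanguage T k + initialLanguage T.swap k + 1 with hC
  have hmemC : ∀ w, w ∈ C ↔ (w ∈ initialLanguage T k ∨ w ∈ initialLanguage T.swap k) ∨ w = [] := by
    intro w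
    rw [hC, Language.add_def, Language.add_def]
    rfl
  obtain ⟨t₀, ht₀, -⟩ := hTsurj 1
  have hCT : ∀ w ∈ C, w ∈ markTree M := by
    intro w hw
    rcases (hmemC w).1 hw with (h | h) | rfl
    · exact initialLanguage_subset hT hK₁ (fun m hm => (hMK m hm).1) hLM (by omega) h
    · exact initialLanguage_subset hT.inverse hK₁' (fun m hm => (hMK m hm).1) hLM' (by omega) h
    · exact IsMarking.mem_markTree_of_prefix ht₀ List.nil_prefix
  have hone : (1 : Language (α × Bool)).IsRegular := by
    refine isRegular_of_invariant (fun w => w = []) fun x y hxy z hz => ?_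
    rw [Language.mem_one, List.append_eq_nil_iff] at hz ⊢
    exact ⟨hxy.mp hz.1, hz.2⟩
  refine hasPrefixClosedSynchronousStructure_of_dense (p := p) (C := C)
    (((initialLanguage_regular T k).add (initialLanguage_regular T.swap k)).add hone) ?_ ?_ ?_
    (wordBall_finite φ (k + 3 * (K₁ + K₁') + K₂)) ?_
  · intro u w huw hw
    rw [hmemC] at hw ⊢
    rcases hw with (h | h) | rfl
    · exact Or.inl (Or.inl (initialLanguage_prefixClosed T k u w huw h))
    · exact Or.inl (Or.inr (initialLanguage_prefixClosed T.swap k u w huw h))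
    · exact Or.inr (List.prefix_nil.1 huw)
  · exact fun u hu v hv h => hTinj u (hCT u hu) v (hCT v hv) h
  · intro g
    obtain ⟨B, hB, h⟩ := hFT g
    exact ⟨B, hB, fun u hu v hv => h u (hCT u hu) v (hCT v hv)⟩
  · intro g
    obtain ⟨t, ⟨m, hm, htm⟩, rfl⟩ := hTsurj g
    have htw : t <+: m.word := htm.trans (List.prefix_append _ _)
    have hlen : 2 * t.length ≤ m.word.length + K₂ := by
      have h1 := (hMK m hm).2
      have h2 := htm.length_le
      have h3 := m.length_word
      omega
    obtain ⟨c, hc, ⟨x, rfl⟩, hx⟩ : ∃ c ∈ C, c <+: t ∧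
        t.length ≤ c.length + (k + 3 * (K₁ + K₁') + K₂) := by
      have hwL : m.word ∈ L ∨ m.word ∈ invLanguage L := by
        obtain ⟨w, hw, ε, rfl⟩ := hMd m hm
        rw [word_signed hs hw]
        cases ε
        · right; simpa [mem_invLanguage] using hw
        · left; simpa using hw
      rcases hwL with hw | hw
      · obtain ⟨c, h1, h2, h3⟩ := exists_mem_initialLanguage (k := k) hT hK₁ hw htw hlen
        exact ⟨c, (hmemC c).2 (by tauto), h2, by omega⟩
      · obtain ⟨c, h1, h2, h3⟩ := exists_mem_initialLanguage (k := k) hT.inverse hK₁' hw htw hlen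
        exact ⟨c, (hmemC c).2 (by tauto), h2, by omega⟩
    refine ⟨c, hc, _, ⟨x, ?_, rfl⟩, ?_⟩
    · simp only [List.length_append] at hx
      simpa using hx
    · rw [eval_append, hp x]

end Quotient

end AutGroup

namespace AutGroup

open FreeGroup

/-! ### Reversal versus inversion in linear languages -/

section Linear

/-- The transducer obtained by inverting the letters of second labels. -/
def Transducer.invertSnd {α V : Type*} (T : Transducer (α × Bool) V) :
    Transducer (α × Bool) V where
  edge p l q := T.edge p (l.1, l.2.map fun a => (a.1, !a.2)) q
  initial := T.initial
  terminal := T.terminal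

theorem Transducer.Path.invertSnd {α V : Type*} {T : Transducer (α × Bool) V} {p q : V}
    {u v : List (α × Bool)} (h : T.Path p q u v) :
    T.invertSnd.Path p q u (v.map fun a => (a.1, !a.2)) := by
  induction h with
  | nil p => exact .nil p
  | cons p q r a b u v he _ ih =>
    have := Path.cons p q r a (b.map fun a => (a.1, !a.2)) _ _ (T := T.invertSnd)
      (by simpa [Transducer.invertSnd, Function.comp_def] using he) ih
    cases b <;> simpa using this

theorem Transducer.invertSnd_invertSnd {α V : Type*} (T : Transducer (α × Bool) V) :
    T.invertSnd.invertSnd = T := by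
  simp [Transducer.invertSnd, Function.comp_def]

theorem exists_isFolding {α : Type*} {L : Language (α × Bool)} (hL : IsLinear L) :
    ∃ (V : Type) (_ : Finite V) (T : Transducer (α × Bool) V), IsFolding T L := by
  obtain ⟨ρ, ⟨V, hV, T, rfl⟩, h⟩ := hL
  refine ⟨V, hV, T.invertSnd, fun w => ?_⟩
  rw [h]
  constructor
  · rintro ⟨⟨u, v⟩, ⟨q, hq, hp⟩, rfl⟩
    exact ⟨(u, v.map fun a : α × Bool => (a.1, !a.2)), ⟨q, hq, hp.invertSnd⟩,
      by simp [invRev, Function.comp_def]⟩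
  · rintro ⟨⟨u, v⟩, ⟨q, hq, hp⟩, rfl⟩
    have := hp.invertSnd
    rw [T.invertSnd_invertSnd] at this
    exact ⟨(u, v.map fun a : α × Bool => (a.1, !a.2)), ⟨q, hq, this⟩, by simp [invRev]⟩

end Linear

/-! ### Length bounds for regular bijective relations -/

section Bound

variable {A : Type*}

theorem pad_injective {u v u' v' : List A} (h : pad u v = pad u' v') : u = u' ∧ v = v' :=
  ⟨by rw [← pad_fst u v, h, pad_fst], by rw [← pad_snd u v, h, pad_snd]⟩

theorem map_swap_pad (u v : List A) : (pad u v).map Prod.swap = pad v u := by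
  induction u generalizing v with
  | nil => cases v <;> simp [pad]
  | cons a u ih =>
    cases v with
    | nil => simp [pad]
    | cons b v => simpa [pad] using ih v

/-- If v outlasted u by more than the number of left quotients, a piece of v read against padding
could be cut out or repeated, giving a second word related to u. -/
theorem exists_length_le_of_functional {rel : List A → List A → Prop}
    (hR : Language.IsRegular ({z | ∃ u v, rel u v ∧ z = pad u v} : Language (Option A × Option A)))
    (hrel : ∀ u v v', rel u v → rel u v' → v = v') :
    ∃ N, ∀ u v, rel u v → v.length ≤ u.length + N := by
  set R : Language (Option A × Option A) := {z | ∃ u v, rel u v ∧ z = pad u v} with hRdef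
  have hfin := hR.finite_range_leftQuotient.fintype
  refine ⟨Fintype.card (Set.range R.leftQuotient), fun u v huv => ?_⟩
  by_contra hlt
  push Not at hlt
  obtain ⟨i, j, hij, heq⟩ := Fintype.exists_ne_map_eq_of_card_lt
    (fun i : Fin (Fintype.card (Set.range R.leftQuotient) + 1) =>
      (⟨_, pad u (v.take (u.length + i)), rfl⟩ : Set.range R.leftQuotient)) (by simp)
  replace heq := congrArg Subtype.val heq
  simp only at heq
  have hi := i.2
  have hj := j.2
  have hne : (i : ℕ) ≠ j := fun h => hij (Fin.ext h)
  have happ : ∀ (k m : ℕ), u.length + k ≤ v.length →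
      pad u (v.take (u.length + k)) ++ pad [] (v.drop m) =
        pad u (v.take (u.length + k) ++ v.drop m) := by
    intro k m hk
    rw [← pad_append, List.append_nil]
    · intro _; rfl
    · intro h; rw [List.length_take] at h; omega
  have h1 : pad u (v.take (u.length + j)) ++ pad [] (v.drop (u.length + j)) ∈ R := by
    rw [happ _ _ (by omega), List.take_append_drop]
    exact ⟨u, v, huv, rfl⟩
  rw [← leftQuotient_congr heq, happ _ _ (by omega)] at h1
  obtain ⟨u', v', h2, h3⟩ := h1
  obtain ⟨rfl, h4⟩ := pad_injective h3
  have h5 := congrArg List.length (h4.trans (hrel _ _ _ h2 huv))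
  simp only [List.length_append, List.length_take, List.length_drop] at h5
  omega

theorem exists_length_bounds {rel : List A → List A → Prop}
    (hR : Language.IsRegular ({z | ∃ u v, rel u v ∧ z = pad u v} : Language (Option A × Option A)))
    (hrel : ∀ u v v', rel u v → rel u v' → v = v')
    (hrel' : ∀ u u' v, rel u v → rel u' v → u = u') :
    ∃ N, ∀ u v, rel u v → v.length ≤ u.length + N ∧ u.length ≤ v.length + N := by
  obtain ⟨N, hN⟩ := exists_length_le_of_functional hR hrel
  set R : Language (Option A × Option A) := {z | ∃ u v, rel u v ∧ z = pad u v}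
  have := hR.finite_range_leftQuotient.to_subtype
  obtain ⟨N', hN'⟩ := exists_length_le_of_functional (rel := fun u v => rel v u) (by
    refine isRegular_of_invariant (fun z =>
      (⟨_, z.map Prod.swap, rfl⟩ : Set.range R.leftQuotient)) ?_
    rintro x y hxy z ⟨u, v, huv, hz⟩
    have h1 := congrArg Subtype.val hxy
    simp only at h1
    have h2 : x.map Prod.swap ++ z.map Prod.swap ∈ R := by
      rw [← List.map_append, hz, map_swap_pad]
      exact ⟨v, u, huv, rfl⟩
    rw [leftQuotient_congr h1, ← List.map_append] at h2
    obtain ⟨v', u', h3, h4⟩ := h2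
    refine ⟨u', v', h3, ?_⟩
    have h5 := congrArg (List.map Prod.swap) h4
    rw [map_swap_pad, List.map_map] at h5
    simpa using h5) (fun u v v' h h' => hrel' _ _ _ h h')
  exact ⟨N + N', fun u v h => ⟨by have := hN u v h; omega, by have := hN' v u h; omega⟩⟩

end Bound

/-! ### A transducer for Schreier generators -/

section Synthesis

/-- A word in the letters of an alphabet as a positive word of the free group. -/
def positive {A : Type*} (u : List A) : List (A × Bool) := u.map fun x => (x, true)

/-- The word of inverses of the letters of a word. -/
def negative {A : Type*} (u : List A) : List (A × Bool) := u.map fun x => (x, false)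

variable {A : Type} {σ : A → Type} (M : ∀ a, DFA (Option A × Option A) (σ a))

/-- The edges of an automaton which chooses a letter `a`, runs the automaton `M a` on two words,
and finally reads `a` on the left. -/
inductive GeneratorEdge : Option (Option (Σ a, σ a)) →
    Option (A × Bool) × Option (A × Bool) → Option (Option (Σ a, σ a)) → Prop
  | start (a : A) : GeneratorEdge none (none, none) (some (some ⟨a, (M a).start⟩))
  | step (a : A) (s : σ a) (c : Option A × Option A) :
      GeneratorEdge (some (some ⟨a, s⟩)) (c.1.map fun x => (x, true), c.2.map fun x => (x, false))
        (some (some ⟨a, (M a).step s c⟩))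
  | finish (a : A) (s : σ a) : s ∈ (M a).accept →
      GeneratorEdge (some (some ⟨a, s⟩)) (some (a, true), none) (some none)

/-- The transducer with edges `GeneratorEdge`. -/
def generatorTransducer : Transducer (A × Bool) (Option (Option (Σ a, σ a))) where
  edge := GeneratorEdge M
  initial := none
  terminal := {some none}

theorem generator_path_of_eval (a : A) (z : List (Option A × Option A)) (s : σ a)
    (h : (M a).evalFrom s z ∈ (M a).accept) :
    (generatorTransducer M).Path (some (some ⟨a, s⟩)) (some none)
      (positive (z.map Prod.fst).reduceOption ++ [(a, true)])
      (negative (z.map Prod.snd).reduceOption) := by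
  induction z generalizing s with
  | nil =>
    exact Transducer.Path.single (T := generatorTransducer M) (GeneratorEdge.finish a s h)
  | cons c z ih =>
    have := Transducer.Path.cons _ _ _ _ _ _ _ (T := generatorTransducer M)
      (GeneratorEdge.step a s c) (ih _ h)
    obtain ⟨c₁, c₂⟩ := c
    cases c₁ <;> cases c₂ <;> simpa [positive, negative] using this

theorem eval_of_generator_path {p q : Option (Option (Σ a, σ a))} {u v : List (A × Bool)}
    (h : (generatorTransducer M).Path p q u v) (hq : q = some none) (a : A) (s : σ a)
    (hp : p = some (some ⟨a, s⟩)) :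
    ∃ z, (M a).evalFrom s z ∈ (M a).accept ∧
      u = positive (z.map Prod.fst).reduceOption ++ [(a, true)] ∧
      v = negative (z.map Prod.snd).reduceOption := by
  induction h generalizing a s with
  | nil p => rw [hp] at hq; simp at hq
  | cons p q r b c u v he hpath ih =>
    subst hp
    cases he with
    | step a s c =>
      obtain ⟨z, h1, rfl, rfl⟩ := ih hq a _ rfl
      refine ⟨c :: z, h1, ?_, ?_⟩
      · obtain ⟨c₁, c₂⟩ := c
        cases c₁ <;> simp [positive]
      · obtain ⟨c₁, c₂⟩ := c
        cases c₂ <;> simp [negative]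
    | finish a s hs =>
      cases hpath with
      | nil => exact ⟨[], hs, by simp [positive], by simp [negative]⟩
      | cons p q r b c u v he _ => cases he

theorem mem_generatorTransducer {x : List (A × Bool) × List (A × Bool)} :
    x ∈ (generatorTransducer M).accepts ↔ ∃ a, ∃ z ∈ (M a).accepts,
      x = (positive (z.map Prod.fst).reduceOption ++ [(a, true)],
        negative (z.map Prod.snd).reduceOption) := by
  constructor
  · rintro ⟨q, hq, h⟩
    obtain rfl : q = some none := hq
    obtain ⟨u, v⟩ := x
    cases h with
    | cons p q r b c u v he hpath =>
      cases he with
      | start a =>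
        obtain ⟨z, h1, rfl, rfl⟩ := eval_of_generator_path M hpath rfl a _ rfl
        exact ⟨a, z, h1, rfl⟩
  · rintro ⟨a, z, hz, rfl⟩
    refine ⟨some none, rfl, ?_⟩
    exact Transducer.Path.cons _ _ _ _ _ _ _ (T := generatorTransducer M)
      (GeneratorEdge.start a) (generator_path_of_eval M a z _ hz)

end Synthesis

end AutGroup

namespace AutGroup

open FreeGroup

/-! ### Positive words -/

section Positive

variable {A : Type*}

theorem length_positive (u : List A) : (positive u).length = u.length := by simp [positive]

theorem positive_append (u v : List A) : positive (u ++ v) = positive u ++ positive v := by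
  simp [positive]

theorem positive_singleton (a : A) : positive [a] = [(a, true)] := rfl

theorem invRev_positive (u : List A) : invRev (positive u) = (negative u).reverse := by
  simp [invRev, positive, negative, Function.comp_def]

theorem isReduced_positive (u : List A) : IsReduced (positive u) := by
  induction u with
  | nil => exact IsReduced.nil
  | cons a u ih =>
    cases u with
    | nil => exact IsReduced.singleton
    | cons b u => exact isReduced_cons_cons.2 ⟨fun _ => rfl, ih⟩

theorem exists_common_prefix (s t : List A) :
    ∃ c s' t', s = c ++ s' ∧ t = c ++ t' ∧ ∀ b ∈ s'.head?, b ∉ t'.head? := by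
  induction s generalizing t with
  | nil => exact ⟨[], [], t, rfl, rfl, by simp⟩
  | cons a s ih =>
    cases t with
    | nil => exact ⟨[], a :: s, [], rfl, rfl, by simp⟩
    | cons b t =>
      by_cases h : a = b
      · subst h
        obtain ⟨c, s', t', rfl, rfl, h⟩ := ih t
        exact ⟨a :: c, s', t', rfl, rfl, h⟩
      · exact ⟨[], a :: s, b :: t, rfl, rfl, by simpa using fun h' => h h'.symm⟩

theorem red_invRev_append (w : List (A × Bool)) : Red (invRev w ++ w) [] := by
  classical
  rw [← reduce_invRev_left_cancel (L := w)]
  exact reduce.red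

theorem red_append_invRev (w : List (A × Bool)) : Red (w ++ invRev w) [] := by
  simpa using red_invRev_append (invRev w)

end Positive

/-! ### Schreier generators of a prefix-closed transversal -/

section Schreier

variable {A G : Type*} [Group G] {p : A → G} {C : Language A}

/-- The triples `(u, a, v)` for which `u a v⁻¹` is a Schreier generator with respect to the
transversal `C`. -/
def SchreierTriple (p : A → G) (C : Language A) (u : List A) (a : A) (v : List A) : Prop :=
  u ∈ C ∧ v ∈ C ∧ eval p (u ++ [a]) = eval p v ∧ u ++ [a] ≠ v

/-- The word `s aᵉ t⁻¹` with its middle letter distinguished. -/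
def markedGenerator (s : List A) (a : A) (ε : Bool) (t : List A) : MarkedWord A :=
  ⟨positive s, (a, ε), invRev (positive t)⟩

theorem signed_markedGenerator (u : List A) (a : A) (v : List A) (ε : Bool) :
    (markedGenerator u a true v).signed ε =
      if ε then markedGenerator u a true v else markedGenerator v a false u := by
  cases ε <;> simp [MarkedWord.signed, MarkedWord.inv, markedGenerator]

/-- Schreier generators and their inverses. -/
def SignedTriple (p : A → G) (C : Language A) (s : List A) (a : A) (ε : Bool) (t : List A) : Prop :=
  if ε then SchreierTriple p C s a t else SchreierTriple p C t a s

/-- If v = v' a, then v' ∈ C, and cancelling a in the group gives u = v'. Thus a does not cancel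
against v⁻¹. -/
theorem SchreierTriple.ne_append (hC : PrefixClosed C) (hU : Uniqueness p C) {u v : List A} {a : A}
    (h : SchreierTriple p C u a v) (v' : List A) : v ≠ v' ++ [a] := by
  rintro rfl
  obtain ⟨hu, hv, huv, hne⟩ := h
  rw [eval_append, eval_append, mul_left_inj] at huv
  exact hne (by rw [hU u hu v' (hC v' _ (List.prefix_append _ _) hv) huv])

/-- By prefix closure it follows that no representative begins with u a, so a is not cancelled by a
neighbouring factor. -/
theorem SchreierTriple.notMem (hU : Uniqueness p C) {u v : List A} {a : A}
    (h : SchreierTriple p C u a v) : u ++ [a] ∉ C := fun h' =>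
  h.2.2.2 (hU _ h' v h.2.1 h.2.2.1)

theorem SchreierTriple.isReduced (hC : PrefixClosed C) (hU : Uniqueness p C) {u v : List A} {a : A}
    (h : SchreierTriple p C u a v) : IsReduced (markedGenerator u a true v).word := by
  have e : (markedGenerator u a true v).word = positive (u ++ [a]) ++ invRev (positive v) := by
    simp [markedGenerator, MarkedWord.word, positive]
  rw [e, isReduced_append_iff]
  refine ⟨isReduced_positive _, isReduced_invRev (isReduced_positive _), fun x hx y hy => ?_⟩
  obtain rfl : x = (a, true) := by simpa [positive, eq_comm] using hx
  rcases List.eq_nil_or_concat v with rfl | ⟨v', b, rfl⟩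
  · simp [positive] at hy
  · rw [List.concat_eq_append, positive_append, positive_singleton, invRev_concat] at hy
    obtain rfl : y = (b, false) := by simpa [eq_comm] using hy
    rintro rfl
    exact absurd (List.concat_eq_append) (h.ne_append hC hU v')

theorem SignedTriple.isReduced (hC : PrefixClosed C) (hU : Uniqueness p C) {s t : List A} {a : A}
    {ε : Bool} (h : SignedTriple p C s a ε t) : IsReduced (markedGenerator s a ε t).word := by
  cases ε
  · have h' : SchreierTriple p C t a s := h
    have := isReduced_invRev (h'.isReduced hC hU)
    rw [← MarkedWord.word_inv] at this
    simpa [markedGenerator, MarkedWord.inv] using this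
  · exact SchreierTriple.isReduced hC hU h

theorem SignedTriple.mem_left {s t : List A} {a : A} {ε : Bool} (h : SignedTriple p C s a ε t) :
    s ∈ C := by
  cases ε
  · exact And.left (And.right h)
  · exact And.left h

theorem SignedTriple.red_nil {s t : List A} {a : A} {ε : Bool} :
    Red ((markedGenerator s a ε t).word ++ (markedGenerator t a (!ε) s).word) [] := by
  have : (markedGenerator t a (!ε) s).word = invRev (markedGenerator s a ε t).word := by
    rw [← MarkedWord.word_inv]; simp [markedGenerator, MarkedWord.inv]
  rw [this]
  exact red_append_invRev _

/-- Nielsen's condition for Schreier generators of a prefix-closed transversal. -/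
theorem SignedTriple.unaffected (hC : PrefixClosed C) (hU : Uniqueness p C)
    {s₁ t₁ s₂ t₂ : List A} {a₁ a₂ : A} {ε₁ ε₂ : Bool} (h₁ : SignedTriple p C s₁ a₁ ε₁ t₁)
    (h₂ : SignedTriple p C s₂ a₂ ε₂ t₂)
    (hne : ¬ Red ((markedGenerator s₁ a₁ ε₁ t₁).word ++ (markedGenerator s₂ a₂ ε₂ t₂).word) []) :
    (markedGenerator s₁ a₁ ε₁ t₁).Unaffected (markedGenerator s₂ a₂ ε₂ t₂) := by
  -- Only the common prefix c cancels. The new junction depends on which of t and s are empty.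
  obtain ⟨c, t, s, rfl, rfl, hts⟩ := exists_common_prefix t₁ s₂
  refine ⟨invRev (positive t) ++ positive s, ?_, ?_⟩
  · have e : (markedGenerator s₁ a₁ ε₁ (c ++ t)).suf ++ (markedGenerator (c ++ s) a₂ ε₂ t₂).pre =
        invRev (positive t) ++ ((invRev (positive c) ++ positive c) ++ positive s) := by
      simp [markedGenerator, positive_append, invRev_append]
    rw [e]
    exact Red.append_append Red.refl (Red.append_append (red_invRev_append _) Red.refl)
  · have e : (markedGenerator s₁ a₁ ε₁ (c ++ t)).pre ++
        (markedGenerator s₁ a₁ ε₁ (c ++ t)).letter ::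
          (invRev (positive t) ++ positive s ++ (markedGenerator (c ++ s) a₂ ε₂ t₂).letter ::
            (markedGenerator (c ++ s) a₂ ε₂ t₂).suf) =
        (positive s₁ ++ (a₁, ε₁) :: invRev (positive t)) ++
          (positive s ++ (a₂, ε₂) :: invRev (positive t₂)) := by
      simp [markedGenerator]
    have r₁ : IsReduced (positive s₁ ++ (a₁, ε₁) :: invRev (positive t)) := by
      refine isReduced_of_prefix (h₁.isReduced hC hU) ⟨invRev (positive c), ?_⟩
      simp [markedGenerator, MarkedWord.word, positive_append, invRev_append]
    have r₂ : IsReduced (positive s ++ (a₂, ε₂) :: invRev (positive t₂)) := by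
      refine (h₂.isReduced hC hU).infix ⟨positive c, [], ?_⟩
      simp [markedGenerator, MarkedWord.word, positive_append]
    rw [e, isReduced_append_iff]
    refine ⟨r₁, r₂, fun x hx y hy hxy => ?_⟩
    cases t with
    | nil =>
      have hx' : x = (a₁, ε₁) := by simpa [positive, eq_comm] using hx
      subst hx'
      cases s with
      | nil =>
        have hy' : y = (a₂, ε₂) := by simpa [positive, eq_comm] using hy
        subst hy'
        have ha : a₁ = a₂ := hxy
        subst ha
        simp only
        -- The two distinguished letters meet as inverses only if the triples are inverse to each
        -- other, and then the product is trivial.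
        by_contra hε
        rw [List.append_nil] at h₁ h₂ hne
        cases ε₁ <;> cases ε₂
        · exact hε rfl
        · obtain ⟨-, g1, g2, -⟩ : SchreierTriple p C c a₁ s₁ := h₁
          obtain ⟨-, g3, g4, -⟩ : SchreierTriple p C c a₁ t₂ := h₂
          obtain rfl := hU _ g1 _ g3 (g2.symm.trans g4)
          exact hne SignedTriple.red_nil
        · obtain ⟨g1, -, g2, -⟩ : SchreierTriple p C s₁ a₁ c := h₁
          obtain ⟨g3, -, g4, -⟩ : SchreierTriple p C t₂ a₁ c := h₂
          have g5 := g2.trans g4.symm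
          rw [eval_append, eval_append, mul_left_inj] at g5
          obtain rfl := hU _ g1 _ g3 g5
          exact hne SignedTriple.red_nil
        · exact hε rfl
      | cons b s =>
        have hy' : y = (b, true) := by simpa [positive, eq_comm] using hy
        subst hy'
        have ha : a₁ = b := hxy
        subst ha
        cases ε₁
        -- Here c a₁ would be a prefix of a word of C.
        · exfalso
          have h₁' : SchreierTriple p C (c ++ []) a₁ s₁ := h₁
          apply h₁'.notMem hU
          exact hC _ _ ⟨s, by simp⟩ h₂.mem_left
        · rfl
    | cons b t =>
      have hx' : x = (b, false) := by
        have e' : positive s₁ ++ (a₁, ε₁) :: invRev (positive (b :: t)) =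
            (positive s₁ ++ (a₁, ε₁) :: invRev (positive t)) ++ [(b, false)] := by
          simp [positive, invRev_cons']
        rw [e', List.getLast?_concat] at hx
        simpa [eq_comm] using hx
      subst hx'
      cases s with
      | nil =>
        have hy' : y = (a₂, ε₂) := by simpa [positive, eq_comm] using hy
        subst hy'
        have ha : b = a₂ := hxy
        subst ha
        cases ε₂
        · rfl
        · exfalso
          have h₂' : SchreierTriple p C (c ++ []) b t₂ := h₂
          apply h₂'.notMem hU
          have hmem : c ++ b :: t ∈ C := by
            cases ε₁
            · exact And.left h₁
            · exact And.left (And.right h₁)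
          exact hC _ _ ⟨t, by simp⟩ hmem
      | cons b' s =>
        have hy' : y = (b', true) := by simpa [positive, eq_comm] using hy
        subst hy'
        have ha : b = b' := hxy
        subst ha
        simp at hts

/-- The Schreier generators with respect to the transversal `C`. -/
def schreierLanguage (p : A → G) (C : Language A) : Language (A × Bool) :=
  {w | ∃ u a v, SchreierTriple p C u a v ∧ w = (markedGenerator u a true v).word}

theorem exists_isSignificant_schreierLanguage [Nonempty A] (hC : PrefixClosed C)
    (hU : Uniqueness p C) :
    ∃ d, IsSignificant (schreierLanguage p C) d ∧ ∀ w ∈ schreierLanguage p C,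
      ∃ u a v, SchreierTriple p C u a v ∧ d w = markedGenerator u a true v := by
  classical
  have hex : ∀ w, ∃ m : MarkedWord A, w ∈ schreierLanguage p C →
      ∃ u a v, SchreierTriple p C u a v ∧ m = markedGenerator u a true v ∧ m.word = w := by
    intro w
    by_cases hw : w ∈ schreierLanguage p C
    · obtain ⟨u, a, v, h, rfl⟩ := hw
      exact ⟨_, fun _ => ⟨u, a, v, h, rfl, rfl⟩⟩
    · exact ⟨⟨[], (Classical.arbitrary A, true), []⟩, fun h => absurd h hw⟩
  choose d hd using hex
  refine ⟨d, ⟨?_, ?_, ?_, ?_⟩, ?_⟩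
  · rintro w ⟨u, a, v, -, rfl⟩
    exact MarkedWord.word_ne_nil _
  · rintro w ⟨u, a, v, h, rfl⟩
    exact h.isReduced hC hU
  · intro w hw
    obtain ⟨-, -, -, -, -, h⟩ := hd w hw
    exact h
  · intro w₁ hw₁ w₂ hw₂ ε₁ ε₂ hne
    obtain ⟨u₁, a₁, v₁, h₁, e₁, -⟩ := hd w₁ hw₁
    obtain ⟨u₂, a₂, v₂, h₂, e₂, -⟩ := hd w₂ hw₂
    rw [e₁, e₂, signed_markedGenerator, signed_markedGenerator] at hne ⊢
    cases ε₁ <;> cases ε₂ <;> exact SignedTriple.unaffected hC hU h₁ h₂ hne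
  · intro w hw
    obtain ⟨u, a, v, h, e, -⟩ := hd w hw
    exact ⟨u, a, v, h, e⟩

theorem lift_mk_positive (u : List A) : FreeGroup.lift p (FreeGroup.mk (positive u)) = eval p u := by
  rw [lift_mk]
  simp [positive, eval, Function.comp_def]

theorem mk_word_markedGenerator (u : List A) (a : A) (v : List A) :
    FreeGroup.mk (markedGenerator u a true v).word =
      FreeGroup.mk (positive u) * FreeGroup.mk [(a, true)] * (FreeGroup.mk (positive v))⁻¹ := by
  rw [inv_mk, mul_mk, mul_mk]
  simp [markedGenerator, MarkedWord.word]

/-- Schreier's lemma for a prefix-closed transversal of a kernel. -/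
theorem generates_schreierLanguage (hC : PrefixClosed C) (hU : Uniqueness p C)
    (hsurj : ∀ g : G, ∃ w ∈ C, eval p w = g) :
    Generates (schreierLanguage p C) (FreeGroup.lift p).ker := by
  set N := Subgroup.closure {g | ∃ w ∈ schreierLanguage p C, FreeGroup.mk w = g} with hN
  have hle : N ≤ (FreeGroup.lift p).ker := by
    rw [hN, Subgroup.closure_le]
    rintro _ ⟨_, ⟨u, a, v, ⟨-, -, h, -⟩, rfl⟩, rfl⟩
    rw [SetLike.mem_coe, MonoidHom.mem_ker, mk_word_markedGenerator, mul_mk,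
      ← positive_singleton, ← positive_append, _root_.map_mul, _root_.map_inv, lift_mk_positive,
      lift_mk_positive, h, mul_inv_cancel]
  have hstep : ∀ u ∈ C, ∀ a, ∀ v ∈ C, eval p (u ++ [a]) = eval p v →
      FreeGroup.mk (positive u) * FreeGroup.mk [(a, true)] * (FreeGroup.mk (positive v))⁻¹ ∈ N := by
    intro u hu a v hv h
    by_cases huv : u ++ [a] = v
    · rw [← huv, positive_append, positive_singleton, ← mul_mk, mul_inv_cancel]
      exact N.one_mem
    · rw [← mk_word_markedGenerator]
      exact Subgroup.subset_closure ⟨_, ⟨u, a, v, ⟨hu, hv, h, huv⟩, rfl⟩, rfl⟩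
  have hnil : [] ∈ C := by
    obtain ⟨w, hw, -⟩ := hsurj 1
    exact hC _ w List.nil_prefix hw
  -- Modulo N every element is represented by a word of C; for an element of the kernel this word is
  -- empty by uniqueness.
  have hrep : ∀ g : List (A × Bool), ∃ u ∈ C,
      FreeGroup.mk g * (FreeGroup.mk (positive u))⁻¹ ∈ N := by
    intro g
    induction g using List.reverseRecOn with
    | nil => exact ⟨[], hnil, by
        have : FreeGroup.mk (positive ([] : List A)) = 1 := rfl
        rw [this, inv_one, mul_one]; exact N.one_mem⟩
    | append_singleton g x ih =>
      obtain ⟨u, hu, hg⟩ := ih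
      obtain ⟨a, b⟩ := x
      cases b
      · obtain ⟨v, hv, h⟩ := hsurj (eval p u * (p a)⁻¹)
        refine ⟨v, hv, ?_⟩
        have h1 := hstep v hv a u hu (by rw [eval_append, h]; simp [eval])
        have h2 := N.mul_mem hg (N.inv_mem h1)
        have h3 : FreeGroup.mk [(a, true)] = (FreeGroup.mk [(a, false)])⁻¹ := rfl
        rw [h3] at h2
        rw [← mul_mk]
        convert h2 using 1
        group
      · obtain ⟨v, hv, h⟩ := hsurj (eval p (u ++ [a]))
        refine ⟨v, hv, ?_⟩
        have h2 := N.mul_mem hg (hstep u hu a v hv h.symm)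
        rw [← mul_mk]
        convert h2 using 1
        group
  refine le_antisymm hle fun g hg => ?_
  classical
  obtain ⟨u, hu, h⟩ := hrep g.toWord
  rw [mk_toWord] at h
  have h1 := hle h
  rw [MonoidHom.mem_ker] at h1 hg
  rw [_root_.map_mul, hg, one_mul, _root_.map_inv, inv_eq_one, lift_mk_positive] at h1
  obtain rfl := hU u hu [] hnil h1
  have h2 : FreeGroup.mk (positive ([] : List A)) = 1 := rfl
  rwa [h2, inv_one, mul_one] at h

end Schreier

end AutGroup

namespace AutGroup

open FreeGroup

/-! ### Linearity and centrality of the Schreier generators -/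

section Automatic

variable {A : Type} {G : Type*} [Group G] {p : A → G} {C : Language A}

theorem isRegular_pad_concat (a : A) :
    Language.IsRegular ({z | ∃ u : List A, z = pad u (u ++ [a])} :
      Language (Option A × Option A)) := by
  refine isRegular_of_invariant
    (fun z => ((∃ u : List A, z = pad u u), ∃ u : List A, z = pad u (u ++ [a]))) ?_
  rintro x y hxy s ⟨u, hu⟩
  simp only [Prod.mk.injEq, eq_iff_iff] at hxy
  obtain ⟨h1, h2⟩ := pad_eq_append hu.symm
  rcases le_or_gt x.length u.length with hle | hlt
  · rw [List.take_append_of_le_length hle] at h1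
    rw [List.drop_append_of_le_length hle] at h2
    obtain ⟨u', rfl⟩ := hxy.1.1 ⟨_, h1⟩
    refine ⟨u' ++ u.drop x.length, ?_⟩
    rw [List.append_assoc, pad_append (fun h => absurd h (lt_irrefl _))
      (fun h => absurd h (lt_irrefl _)), h2]
  · rw [List.take_of_length_le hlt.le, List.take_of_length_le (by simp; omega)] at h1
    rw [List.drop_eq_nil_of_le hlt.le, List.drop_eq_nil_of_le (by simp; omega)] at h2
    obtain ⟨u', rfl⟩ := hxy.2.1 ⟨_, h1⟩
    exact ⟨u', by rw [h2]; simp [pad]⟩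

/-- The multiplier language of a is intersected with the complement of the trivial pairs (u, u a).
-/
theorem isRegular_schreierTriple (h : IsSynchronousAutomatic p C) (a : A) :
    Language.IsRegular ({z | ∃ u v, SchreierTriple p C u a v ∧ z = pad u v} :
      Language (Option A × Option A)) := by
  have := (h.multiplier (some a)).inf (isRegular_pad_concat a).compl
  refine (congrArg Language.IsRegular (Set.ext fun z => ?_)).mpr this
  constructor
  · rintro ⟨u, v, ⟨hu, hv, huv, hne⟩, rfl⟩
    refine ⟨⟨u, hu, v, hv, huv, rfl⟩, ?_⟩
    rintro ⟨u', hu'⟩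
    obtain ⟨rfl, rfl⟩ := pad_injective hu'
    exact hne rfl
  · rintro ⟨⟨u, hu, v, hv, huv, rfl⟩, hne⟩
    exact ⟨u, v, ⟨hu, hv, huv, fun h => hne ⟨u, by rw [← h]⟩⟩, rfl⟩

theorem isLinear_schreierLanguage [Finite A] (h : IsSynchronousAutomatic p C) :
    IsLinear (schreierLanguage p C) := by
  choose σ hσ M hM using fun a => isRegular_schreierTriple h a
  have hfin : ∀ a, Finite (σ a) := fun a => (hσ a).finite
  refine ⟨(generatorTransducer M).accepts, ⟨_, inferInstance, _, rfl⟩, fun w => ?_⟩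
  have hword : ∀ (u : List A) (a : A) (v : List A), (markedGenerator u a true v).word =
      (positive u ++ [(a, true)]) ++ (negative v).reverse := by
    intro u a v
    simp [markedGenerator, MarkedWord.word, invRev_positive]
  constructor
  · rintro ⟨u, a, v, huv, rfl⟩
    refine ⟨_, (mem_generatorTransducer M).2 ⟨a, pad u v, ?_, rfl⟩, ?_⟩
    · rw [hM]; exact ⟨u, v, huv, rfl⟩
    · rw [pad_fst, pad_snd, hword]
  · rintro ⟨x, hx, rfl⟩
    obtain ⟨a, z, hz, rfl⟩ := (mem_generatorTransducer M).1 hx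
    rw [hM] at hz
    obtain ⟨u, v, huv, rfl⟩ := hz
    exact ⟨u, a, v, huv, by rw [pad_fst, pad_snd, hword]⟩

/-- By uniqueness u and v determine each other once a is fixed, so `exists_length_bounds` applies.
-/
theorem exists_schreierTriple_length_le [Finite A] (h : IsSynchronousAutomatic p C)
    (hU : Uniqueness p C) : ∃ N, ∀ u a v, SchreierTriple p C u a v →
      v.length ≤ u.length + N ∧ u.length ≤ v.length + N := by
  have hb : ∀ a, ∃ N, ∀ u v, SchreierTriple p C u a v →
      v.length ≤ u.length + N ∧ u.length ≤ v.length + N := by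
    refine fun a => exists_length_bounds (isRegular_schreierTriple h a) ?_ ?_
    · rintro u v v' ⟨-, h1, h2, -⟩ ⟨-, h3, h4, -⟩
      exact hU v h1 v' h3 (h2.symm.trans h4)
    · rintro u u' v ⟨h1, -, h2, -⟩ ⟨h3, -, h4, -⟩
      have h5 := h2.trans h4.symm
      rw [eval_append, eval_append, mul_left_inj] at h5
      exact hU u h1 u' h3 h5
  choose N hN using hb
  obtain ⟨K, hK⟩ := (Set.finite_range N).bddAbove
  refine ⟨K, fun u a v huv => ?_⟩
  have h1 := hN a u v huv
  have h2 := hK ⟨a, rfl⟩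
  omega

theorem isKCentral_schreierLanguage [Finite A] (h : IsSynchronousAutomatic p C)
    (hU : Uniqueness p C) {d : List (A × Bool) → MarkedWord A}
    (hd : ∀ w ∈ schreierLanguage p C,
      ∃ u a v, SchreierTriple p C u a v ∧ d w = markedGenerator u a true v) :
    IsKCentral (schreierLanguage p C) d := by
  obtain ⟨N, hN⟩ := exists_schreierTriple_length_le h hU
  refine ⟨N, fun w hw => ?_⟩
  obtain ⟨u, a, v, huv, e⟩ := hd w hw
  obtain ⟨h1, h2⟩ := hN u a v huv
  rw [e, MarkedWord.distCenter, MarkedWord.length_word]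
  simp only [markedGenerator, length_positive, invRev_length]
  have h1' : (v.length : ℝ) ≤ u.length + N := by exact_mod_cast h1
  have h2' : (u.length : ℝ) ≤ v.length + N := by exact_mod_cast h2
  rw [abs_le]
  push_cast
  constructor <;> linarith

/-- The function distinguishing letters needs values outside the language, hence some letter. Over
an empty alphabet G is trivial, and the empty word over one letter serves as well. -/
theorem exists_nonempty_structure (h : HasPrefixClosedSynchronousStructure G) :
    ∃ (A : Type) (_ : Finite A) (_ : Nonempty A) (p : A → G) (C : Language A),
      IsSynchronousAutomatic p C ∧ PrefixClosed C ∧ Uniqueness p C := by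
  obtain ⟨A, hA, p, C, h1, h2, h3⟩ := h
  rcases isEmpty_or_nonempty A with hA' | hA'
  · have hG : ∀ g : G, g = 1 := by
      intro g
      obtain ⟨w, -, rfl⟩ := h1.surjective g
      rw [Subsingleton.elim w []]
      rfl
    refine ⟨Unit, inferInstance, inferInstance, fun _ => 1, {w | w = []},
      isSynchronousAutomatic_of_fellowTravel _ ?_ ?_ ?_, ?_, ?_⟩
    · refine isRegular_of_invariant (fun w => w = []) fun x y hxy z hz => ?_
      have hz' := List.append_eq_nil_iff.1 hz
      exact List.append_eq_nil_iff.2 ⟨hxy.mp hz'.1, hz'.2⟩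
    · intro g
      exact ⟨[], rfl, (hG _).trans (hG g).symm⟩
    · intro g
      exact ⟨{1}, Set.finite_singleton 1, fun u _ v _ _ m => hG _⟩
    · rintro u w huw hw
      obtain rfl : w = [] := hw
      exact List.prefix_nil.1 huw
    · intro u hu v hv _
      exact Eq.trans hu (Eq.symm hv)
  · exact ⟨A, hA, hA', p, C, h1, h2, h3⟩

end Automatic

/-! ### Assembling the equivalences -/

section Equivalence

variable {G : Type*} [Group G]

theorem IsKCentral.isOCentral {α : Type*} {L : Language (α × Bool)}
    {d : List (α × Bool) → MarkedWord α} (h : IsKCentral L d) : IsOCentral L d := by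
  obtain ⟨k, hk⟩ := h
  right
  intro c hc
  obtain ⟨n, hn⟩ := exists_nat_ge (k / c)
  refine ⟨n, fun w hw hlen => (hk w hw).trans ?_⟩
  rw [div_le_iff₀' hc] at hn
  exact hn.trans (mul_le_mul_of_nonneg_left (by exact_mod_cast hlen) hc.le)

theorem exists_kCentral (h : HasPrefixClosedSynchronousStructure G) :
    ∃ (α : Type) (_ : Finite α) (N : Subgroup (FreeGroup α)) (_ : N.Normal)
      (_ : Nonempty (G ≃* FreeGroup α ⧸ N)) (L : Language (α × Bool))
      (d : List (α × Bool) → MarkedWord α),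
      IsLinear L ∧ Generates L N ∧ IsSignificant L d ∧ IsKCentral L d := by
  obtain ⟨A, hA, hA', p, C, h1, h2, h3⟩ := exists_nonempty_structure h
  obtain ⟨d, hd, hd'⟩ := exists_isSignificant_schreierLanguage (p := p) h2 h3
  have hsurj : Function.Surjective (FreeGroup.lift p) := by
    intro g
    obtain ⟨w, -, rfl⟩ := h1.surjective g
    exact ⟨_, lift_mk_positive w⟩
  exact ⟨A, hA, (FreeGroup.lift p).ker, inferInstance,
    ⟨(QuotientGroup.quotientKerEquivOfSurjective _ hsurj).symm⟩, schreierLanguage p C, d,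
    isLinear_schreierLanguage h1, generates_schreierLanguage h2 h3 h1.surjective, hd,
    isKCentral_schreierLanguage h1 h3 hd'⟩

theorem hasPrefixClosedSynchronousStructure_of_oCentral {α : Type} [Finite α]
    {N : Subgroup (FreeGroup α)} [N.Normal] (e : G ≃* FreeGroup α ⧸ N) {L : Language (α × Bool)}
    {d : List (α × Bool) → MarkedWord α} (hL : IsLinear L) (hN : Generates L N)
    (hs : IsSignificant L d) (ho : IsOCentral L d) : HasPrefixClosedSynchronousStructure G := by
  obtain ⟨V, hV, T, hT⟩ := exists_isFolding hL
  set φ : FreeGroup α →* G := e.symm.toMonoidHom.comp (QuotientGroup.mk' N) with hφ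
  have hker : φ.ker = N := by
    ext g
    rw [MonoidHom.mem_ker, hφ]
    simp
  refine hasPrefixClosedSynchronousStructure_of_isFolding (φ := φ) ?_ hT (by rwa [hker]) hs ho
  exact e.symm.surjective.comp (QuotientGroup.mk'_surjective N)

end Equivalence

end AutGroup

theorem theorem2 (G : Type*) [Group G] :
    (AutGroup.HasPrefixClosedSynchronousStructure G ↔
      ∃ (α : Type) (_ : Finite α) (N : Subgroup (FreeGroup α)) (_ : N.Normal)
        (_ : Nonempty (G ≃* FreeGroup α ⧸ N)) (L : Language (α × Bool))
        (d : List (α × Bool) → AutGroup.MarkedWord α),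
        AutGroup.IsLinear L ∧ AutGroup.Generates L N ∧ AutGroup.IsSignificant L d ∧
          AutGroup.IsKCentral L d) ∧
    (AutGroup.HasPrefixClosedSynchronousStructure G ↔
      ∃ (α : Type) (_ : Finite α) (N : Subgroup (FreeGroup α)) (_ : N.Normal)
        (_ : Nonempty (G ≃* FreeGroup α ⧸ N)) (L : Language (α × Bool))
        (d : List (α × Bool) → AutGroup.MarkedWord α),
        AutGroup.IsLinear L ∧ AutGroup.Generates L N ∧ AutGroup.IsSignificant L d ∧
          AutGroup.IsOCentral L d) ∧
    (∀ (α : Type) (_ : Finite α) (N : Subgroup (FreeGroup α)) (_ : N.Normal)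
        (_ : Nonempty (G ≃* FreeGroup α ⧸ N)) (L : Language (α × Bool))
        (d : List (α × Bool) → AutGroup.MarkedWord α),
        AutGroup.IsLinear L → AutGroup.Generates L N → AutGroup.IsSignificant L d →
          AutGroup.IsOCentral L d →
          (∀ τ : Set (List (α × Bool) × List (α × Bool)), AutGroup.IsRationalTransduction τ →
            (∀ w, w ∈ L ↔ ∃ x ∈ τ, w = x.1 ++ FreeGroup.invRev x.2) →
            AutGroup.IsSynchronized τ) ∧
          ∃ k : ℕ, ∀ w ∈ L,
            AutGroup.SyncFellowTravel N k (d w).pre (FreeGroup.invRev (d w).suf)) := by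
  refine ⟨⟨AutGroup.exists_kCentral, ?_⟩, ⟨?_, ?_⟩, ?_⟩
  · rintro ⟨α, _, N, _, ⟨e⟩, L, d, hL, hN, hs, hk⟩
    exact AutGroup.hasPrefixClosedSynchronousStructure_of_oCentral e hL hN hs hk.isOCentral
  · intro h
    obtain ⟨α, h1, N, h2, h3, L, d, hL, hN, hs, hk⟩ := AutGroup.exists_kCentral h
    exact ⟨α, h1, N, h2, h3, L, d, hL, hN, hs, hk.isOCentral⟩
  · rintro ⟨α, _, N, _, ⟨e⟩, L, d, hL, hN, hs, ho⟩
    exact AutGroup.hasPrefixClosedSynchronousStructure_of_oCentral e hL hN hs ho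
  · intro α _ N _ _ L d hL hN hs ho
    constructor
    · rintro _ ⟨V, _, T, rfl⟩ hT
      exact AutGroup.isSynchronized_of_isFolding hT hs ho
    · obtain ⟨V, _, T, hT⟩ := AutGroup.exists_isFolding hL
      refine AutGroup.exists_syncFellowTravel hT hs ho fun w hw => ?_
      rw [← hN]
      exact Subgroup.subset_closure ⟨w, hw, rfl⟩
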